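/- Let $n\ge 1$, let $p>1+\frac2n$, and let $f\colon\mathbb R\to\mathbb R$ satisfy $f(0)=0$ and, for some $K>0$, $$|f(\xi)-f(\eta)|\le K\left(|\xi|^{p-1}+|\eta|^{p-1}\right)|\xi-\eta|\qquad(\xi,\eta\in\mathbb R).$$ Let $G_t(x)=(4\pi t)^{-n/2}e^{-|x|^2/(4t)}$ be the Gauss kernel on $\mathbb R^n$, let $e^{t\Delta}\psi=G_t*\psi$ for $t>0$ and $e^{0\Delta}\psi=\psi$, and write $\|\cdot\|_q$ for the norm of $L^q(\mathbb R^n)$. Put $$X=(C\cap L^\infty)\left([0,\infty);L^1(\mathbb R^n)\right)\cap(C\cap L^\infty)\left((0,\infty);L^\infty(\mathbb R^n)\right).$$ A global solution in $X$ of $$\partial_t u-\Delta u=f(u)\ \text{ in }(0,\infty)\times\mathbb R^n,\qquad u(0)=\varphi,$$ is a function $u\in X$ with $u(t)=e^{t\Delta}\varphi+\int_0^t e^{(t-s)\Delta}f(u(s))\,ds$ for all $t\ge0$, the integral being a Bochner integral in $L^1(\mathbb R^n)$. Then there is $\varepsilon_0>0$ such that, for every $\varphi\in L^1(\mathbb R^n)\cap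 L^\infty(\mathbb R^n)$ with $\|\varphi\|_1+\|\varphi\|_\infty\le\varepsilon_0$, this problem has a unique global solution $u\in X$, which satisfies $$\sup_{q\in[1,\infty]}\ \sup_{t\ge0}\ (1+t)^{\frac n2\left(1-\frac1q\right)}\|u(t)\|_q<\infty,$$ and such that the following holds. Let $m\ge0$ be an integer with $p>1+\frac{2+m}{n}$, and suppose that $\varphi\in L^1_m(\mathbb R^n)$, that is, $x^\alpha\varphi\in L^1(\mathbb R^n)$ for all multi-indices $\alpha\in\mathbb Z_{\ge0}^n$ with $|\alpha|\le m$. Then the integral in $$\varphi_1:=\varphi+\int_0^\infty f(u(s))\,ds$$ converges as a Bochner integral in $L^1(\mathbb R^n)$, $\varphi_1\in L^1_m(\mathbb R^n)$, and for every $q\in[1,\infty]$ $$\lim_{t\to\infty}t^{\frac n2\left(1-\frac1q\right)}\left\|u(t)-\sum_{k=0}^m2^{-k}t^{-\frac k2}\sum_{|\alpha|=k}c_\alpha\,\delta_t(h_\alpha G_1)\right\|_q=0 .$$ Here $$c_\alpha=\frac1{\alpha!}\int_{\mathbb R^n}y^\alpha\varphi_1(y)\,dy,\qquad(\delta_t\psi)(x)=t^{-\frac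 n2}\psi\left(t^{-\frac12}x\right),$$ $$h_\alpha(x)=\prod_{j=1}^nH_{\alpha_j}\left(\frac{x_j}2\right),\qquad H_k(x)=(-1)^ke^{x^2}\frac{d^k}{dx^k}e^{-x^2}.$$ -/

import Mathlib

open MeasureTheory Filter Topology Set
open scoped ENNReal NNReal

noncomputable section

namespace SemilinearHeat

/-- Euclidean space `ℝⁿ`. -/
abbrev Space (n : ℕ) := EuclideanSpace ℝ (Fin n)

/-- The Banach space `L¹(ℝⁿ)` of real functions modulo almost everywhere equality. -/
abbrev L1 (n : ℕ) := Lp ℝ 1 (volume : Measure (Space n))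

variable {n : ℕ}

/-! ### Multi-indices -/

/-- The monomial `x ^ α`. -/
def monomial (α : Fin n → ℕ) (x : Space n) : ℝ := ∏ j, x j ^ α j

/-- The multi-index factorial `α!`. -/
def multiFactorial (α : Fin n → ℕ) : ℕ := ∏ j, (α j).factorial

/-- The weighted space `L¹ₘ(ℝⁿ)`: every `x ^ α φ` with `|α| ≤ m` is integrable
(`α = 0` is the integrability of `φ` itself). -/
def MemL1Weighted (m : ℕ) (φ : Space n → ℝ) : Prop :=
  ∀ α : Fin n → ℕ, ∑ j, α j ≤ m → Integrable (fun x => monomial α x * φ x) volume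

/-! ### The heat semigroup -/

/-- The Gauss kernel `G_t(x) = (4πt)^{-n/2} exp(-|x|²/(4t))`. -/
def gaussKernel (t : ℝ) (x : Space n) : ℝ :=
  (4 * Real.pi * t) ^ (-(n : ℝ) / 2) * Real.exp (-‖x‖ ^ 2 / (4 * t))

/-- The heat semigroup `e^{tΔ}`: convolution with `G_t` for `t > 0`, the identity for `t = 0`. -/
def heat (t : ℝ) (ψ : Space n → ℝ) : Space n → ℝ :=
  if 0 < t then fun x => ∫ y, gaussKernel t (x - y) * ψ y else ψ

open Classical in
/-- The class in `L¹(ℝⁿ)` of an integrable function. (The value for a non-integrable function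
is irrelevant: below it is applied to integrable functions only.) -/
def toL1 (ψ : Space n → ℝ) : L1 n :=
  if h : MemLp ψ 1 volume then h.toLp ψ else 0

/-! ### Solutions of the Cauchy problem -/

/-- The class `X = (C ∩ L^∞)([0,∞); L¹) ∩ (C ∩ L^∞)((0,∞); L^∞)`. Only the values of `u` on
`[0,∞)` matter. -/
structure MemX (u : ℝ → L1 n) : Prop where
  continuousOn_L1 : ContinuousOn u (Ici 0)
  bounded_L1 : ∃ M : ℝ, ∀ t : ℝ, 0 ≤ t → ‖u t‖ ≤ M
  bounded_Linfty : ∃ M : ℝ≥0, ∀ t : ℝ, 0 < t → eLpNorm (u t) ∞ volume ≤ M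
  continuous_Linfty : ∀ t : ℝ, 0 < t →
    Tendsto (fun s : ℝ => eLpNorm (⇑(u s) - ⇑(u t)) ∞ volume) (𝓝 t) (𝓝 0)

/-- `u ∈ X` is a global (mild) solution of `∂ₜu - Δu = f(u)`, `u(0) = φ`: for every `t ≥ 0`,
`u(t) = e^{tΔ} φ + ∫₀ᵗ e^{(t-s)Δ} f(u(s)) ds`, the integral being a convergent
Bochner integral in `L¹(ℝⁿ)`. -/
structure IsGlobalSolution (f : ℝ → ℝ) (φ : Space n → ℝ) (u : ℝ → L1 n) : Prop where
  memX : MemX u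
  integrable : ∀ t : ℝ, 0 ≤ t →
    IntervalIntegrable (fun s => toL1 (heat (t - s) (fun x => f (u s x)))) volume 0 t
  integral_equation : ∀ t : ℝ, 0 ≤ t →
    u t = toL1 (heat t φ) + ∫ s in (0 : ℝ)..t, toL1 (heat (t - s) (fun x => f (u s x)))

/-! ### The asymptotic profile -/

/-- `φ₁ = φ + ∫₀^∞ f(u(s)) ds`, a Bochner integral in `L¹(ℝⁿ)`. -/
def phiOne (f : ℝ → ℝ) (φ : Space n → ℝ) (u : ℝ → L1 n) : L1 n :=
  toL1 φ + ∫ s in Ioi (0 : ℝ), toL1 (fun x => f (u s x))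

/-- The normalized moment `(1/α!) ∫ y ^ α ψ(y) dy`. -/
def momentCoeff (ψ : Space n → ℝ) (α : Fin n → ℕ) : ℝ :=
  (1 / (multiFactorial α : ℝ)) * ∫ y, monomial α y * ψ y

/-- The (physicists') Hermite polynomial `H_k(x) = (-1)^k e^{x²} (d/dx)^k e^{-x²}`. -/
def hermite (k : ℕ) (x : ℝ) : ℝ :=
  (-1) ^ k * Real.exp (x ^ 2) * iteratedDeriv k (fun y : ℝ => Real.exp (-y ^ 2)) x

/-- `h_α(x) = H_α(x/2)`, where `H_α` is the tensor product of the `H_{α_j}`. -/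
def hermiteScaled (α : Fin n → ℕ) (x : Space n) : ℝ := ∏ j, hermite (α j) (x j / 2)

/-- The dilation `(δ_t ψ)(x) = t^{-n/2} ψ(t^{-1/2} x)`. -/
def dilation (t : ℝ) (ψ : Space n → ℝ) (x : Space n) : ℝ :=
  t ^ (-(n : ℝ) / 2) * ψ (t ^ (-(1 : ℝ) / 2) • x)

/-- `∑_{k ≤ m} 2^{-k} t^{-k/2} ∑_{|α| = k} c_α δ_t(h_α G₁)`. -/
def profile (m : ℕ) (c : (Fin n → ℕ) → ℝ) (t : ℝ) (x : Space n) : ℝ :=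
  ∑ k ∈ Finset.range (m + 1), (2 : ℝ) ^ (-(k : ℝ)) * t ^ (-(k : ℝ) / 2) *
    ∑ α ∈ Finset.piAntidiag (Finset.univ : Finset (Fin n)) k,
      c α * dilation t (fun y => hermiteScaled α y * gaussKernel 1 y) x

/-- The exponent `(n/2)(1 - 1/q)` for `q ∈ [1,∞]`, with `1/∞ = 0`. -/
def decayExponent (n : ℕ) (q : ℝ≥0∞) : ℝ := (n : ℝ) / 2 * (1 - (1 / q).toReal)

end SemilinearHeat

end

open SemilinearHeat

/-! The nonlinearity is a perturbation controlled in the lattice order of L¹. If |u(s)| ≤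
2e^{sΔ}|φ|, and this bound is at most a(s) = E(1+s)^{-n/2}, then |f(u(s))| ≤ 2K a(s)^{p-1}
e^{sΔ}|φ|, so positivity and the semigroup law give |e^{(t-s)Δ}f(u(s))| ≤ 2K a(s)^{p-1} e^{tΔ}|φ|
(`SmallData.abs_integrand_le`). The condition p > 1+2/n makes K a^{p-1} integrable on (0,∞), with
integral at most 1/4 for small data (`exists_smallData`). Hence the Duhamel map preserves the
dominated functions and contracts them in sup_t ‖·‖₁. The fixed point inherits the decay of the heat
flow by interpolation between L¹ and L^∞; uniqueness in X is Gronwall.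

For large times, restart at T. The Duhamel integral after T is a small multiple of e^{tΔ}|φ|, and
u(T) is its mass times G_T plus a mean-zero function, whose heat flow is negligible
(`tendsto_norm_heatL1_of_integral_eq_zero`). The mass of u(T) tends to ∫φ₁, so u(t) is asymptotic to
(∫φ₁)G_t (`SmallData.eventually_heatSmall`). The claimed limit carries no factor t^{m/2}: the terms
k ≥ 1 of the profile are O(t^{-k/2}) and vanish in it (`tendsto_weighted_eLpNorm_remainder`), so
leading order suffices. What p > 1+(2+m)/n brings is φ₁ ∈ L¹_m: the moments of e^{sΔ}|φ| grow at
most like (1+s)^{m/2}, still integrable against a^{p-1} (`SmallData.integrable_weight_mul`). -/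

namespace SemilinearHeat

variable {n : ℕ}

/-! ### The Gauss kernel -/

lemma gaussKernel_nonneg (t : ℝ) (ht : 0 ≤ t) (x : Space n) : 0 ≤ gaussKernel t x := by
  unfold gaussKernel; positivity

lemma gaussKernel_le {t : ℝ} (ht : 0 < t) (x : Space n) :
    gaussKernel t x ≤ (4 * Real.pi * t) ^ (-(n : ℝ) / 2) := by
  unfold gaussKernel
  refine mul_le_of_le_one_right (by positivity) (Real.exp_le_one_iff.2 ?_)
  rw [neg_div]
  have : 0 ≤ ‖x‖ ^ 2 / (4 * t) := by positivity
  linarith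

lemma continuous_gaussKernel (t : ℝ) : Continuous (gaussKernel t : Space n → ℝ) := by
  unfold gaussKernel; fun_prop

lemma gaussKernel_eq_exp {t : ℝ} (x : Space n) :
    gaussKernel t x =
      (4 * Real.pi * t) ^ (-(n : ℝ) / 2) * Real.exp (-(1 / (4 * t)) * ‖x‖ ^ 2) := by
  unfold gaussKernel; congr 2; ring

lemma integral_gaussKernel {t : ℝ} (ht : 0 < t) : ∫ x : Space n, gaussKernel t x = 1 := by
  simp_rw [gaussKernel_eq_exp]
  rw [integral_const_mul, GaussianFourier.integral_rexp_neg_mul_sq_norm (by positivity)]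
  simp only [finrank_euclideanSpace, Fintype.card_fin]
  rw [show Real.pi / (1 / (4 * t)) = 4 * Real.pi * t by field_simp,
    ← Real.rpow_add (by positivity)]
  simp [neg_div]

lemma integrable_gaussKernel {t : ℝ} (ht : 0 < t) :
    Integrable (gaussKernel t : Space n → ℝ) :=
  integrable_of_integral_eq_one (integral_gaussKernel ht)

/-- Completing the square in y. The second factor on the right is a translated Gauss kernel, so
integrating in y yields the semigroup law. -/
lemma gaussKernel_mul {t s : ℝ} (ht : 0 < t) (hs : 0 < s) (x y : Space n) :
    gaussKernel t (x - y) * gaussKernel s y =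
      gaussKernel (t + s) x * gaussKernel (t * s / (t + s)) (y - (s / (t + s)) • x) := by
  have hts : 0 < t + s := by positivity
  unfold gaussKernel
  have h : 4 * Real.pi * t * (4 * Real.pi * s) =
      4 * Real.pi * (t + s) * (4 * Real.pi * (t * s / (t + s))) := by field_simp
  rw [mul_mul_mul_comm, mul_mul_mul_comm ((4 * Real.pi * (t + s)) ^ _), ← Real.exp_add,
    ← Real.exp_add, ← Real.mul_rpow (by positivity) (by positivity),
    ← Real.mul_rpow (by positivity) (by positivity), h]
  congr 2
  rw [norm_sub_sq_real, norm_sub_sq_real, inner_smul_right, norm_smul, Real.norm_eq_abs,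
    mul_pow, sq_abs, real_inner_comm]
  field_simp
  ring

lemma integral_gaussKernel_mul {t s : ℝ} (ht : 0 < t) (hs : 0 < s) (x : Space n) :
    ∫ y, gaussKernel t (x - y) * gaussKernel s y = gaussKernel (t + s) x := by
  simp_rw [gaussKernel_mul ht hs]
  rw [integral_const_mul, integral_sub_right_eq_self (gaussKernel (t * s / (t + s))),
    integral_gaussKernel (by positivity), mul_one]

lemma gaussKernel_scale {t : ℝ} (ht : 0 < t) (x : Space n) :
    gaussKernel t x = t ^ (-(n : ℝ) / 2) * gaussKernel 1 (t ^ (-(1 : ℝ) / 2) • x) := by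
  have h : ‖t ^ (-(1 : ℝ) / 2) • x‖ ^ 2 = ‖x‖ ^ 2 / t := by
    rw [norm_smul, Real.norm_of_nonneg (by positivity), mul_pow, ← Real.rpow_natCast (t ^ _),
      ← Real.rpow_mul ht.le]
    norm_num [Real.rpow_neg_one]
    ring
  unfold gaussKernel
  rw [h, Real.mul_rpow (by positivity) ht.le, ← mul_assoc, mul_one]
  congr 1
  · ring
  · congr 1; field_simp

/-! ### The heat semigroup on functions -/

lemma heat_of_pos {t : ℝ} (ht : 0 < t) (ψ : Space n → ℝ) (x : Space n) :
    heat t ψ x = ∫ y, gaussKernel t (x - y) * ψ y := by simp [heat, ht]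

lemma heat_of_nonpos {t : ℝ} (ht : t ≤ 0) (ψ : Space n → ℝ) : heat t ψ = ψ := by
  simp [heat, ht.not_gt]

lemma heat_eq_convolution {t : ℝ} (ht : 0 < t) (ψ : Space n → ℝ) :
    heat t ψ = convolution (gaussKernel t) ψ (ContinuousLinearMap.mul ℝ ℝ) volume := by
  ext x; rw [heat_of_pos ht, convolution_mul_swap]

lemma integrable_heat {ψ : Space n → ℝ} (hψ : Integrable ψ) (t : ℝ) :
    Integrable (heat t ψ) := by
  rcases le_or_gt t 0 with ht | ht
  · rwa [heat_of_nonpos ht]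
  · rw [heat_eq_convolution ht]
    exact (integrable_gaussKernel ht).integrable_convolution _ hψ

lemma integral_heat {ψ : Space n → ℝ} (hψ : Integrable ψ) (t : ℝ) :
    ∫ x, heat t ψ x = ∫ x, ψ x := by
  rcases le_or_gt t 0 with ht | ht
  · rw [heat_of_nonpos ht]
  · rw [heat_eq_convolution ht, integral_convolution _ (integrable_gaussKernel ht) hψ,
      integral_gaussKernel ht]
    simp

lemma integrable_gaussKernel_mul {ψ : Space n → ℝ} (hψ : Integrable ψ) {t : ℝ} (ht : 0 < t)
    (x : Space n) : Integrable (fun y => gaussKernel t (x - y) * ψ y) := by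
  refine hψ.bdd_mul (c := (4 * Real.pi * t) ^ (-(n : ℝ) / 2))
    ((continuous_gaussKernel t).comp (continuous_const.sub continuous_id)).aestronglyMeasurable ?_
  filter_upwards with y
  rw [Real.norm_of_nonneg (gaussKernel_nonneg t ht.le _)]
  exact gaussKernel_le ht _

lemma heat_congr {ψ χ : Space n → ℝ} (h : ψ =ᵐ[volume] χ) (t : ℝ) :
    heat t ψ =ᵐ[volume] heat t χ := by
  rcases le_or_gt t 0 with ht | ht
  · rwa [heat_of_nonpos ht, heat_of_nonpos ht]
  · filter_upwards with x
    rw [heat_of_pos ht, heat_of_pos ht]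
    exact integral_congr_ae (by filter_upwards [h] with y hy; rw [hy])

lemma heat_add {ψ χ : Space n → ℝ} (hψ : Integrable ψ) (hχ : Integrable χ) (t : ℝ) :
    heat t (ψ + χ) = heat t ψ + heat t χ := by
  rcases le_or_gt t 0 with ht | ht
  · simp [heat_of_nonpos ht]
  · ext x
    simp only [heat_of_pos ht, Pi.add_apply, mul_add]
    exact integral_add (integrable_gaussKernel_mul hψ ht x) (integrable_gaussKernel_mul hχ ht x)

lemma heat_smul (c : ℝ) (ψ : Space n → ℝ) (t : ℝ) : heat t (c • ψ) = c • heat t ψ := by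
  rcases le_or_gt t 0 with ht | ht
  · simp [heat_of_nonpos ht]
  · ext x
    simp only [heat_of_pos ht, Pi.smul_apply, smul_eq_mul, ← integral_const_mul]
    congr 1; ext y; ring

lemma heat_nonneg {ψ : Space n → ℝ} (h : 0 ≤ᵐ[volume] ψ) (t : ℝ) :
    0 ≤ᵐ[volume] heat t ψ := by
  rcases le_or_gt t 0 with ht | ht
  · rwa [heat_of_nonpos ht]
  · filter_upwards with x
    rw [heat_of_pos ht]
    refine integral_nonneg_of_ae ?_
    filter_upwards [h] with y hy
    exact mul_nonneg (gaussKernel_nonneg t ht.le _) hy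

lemma abs_heat_le (ψ : Space n → ℝ) (t : ℝ) (x : Space n) :
    |heat t ψ x| ≤ heat t (fun y => |ψ y|) x := by
  rcases le_or_gt t 0 with ht | ht
  · simp [heat_of_nonpos ht]
  · rw [heat_of_pos ht, heat_of_pos ht]
    refine abs_integral_le_integral_abs.trans_eq ?_
    simp_rw [abs_mul, abs_of_nonneg (gaussKernel_nonneg t ht.le _)]

lemma abs_heat_le_of_integrable {ψ : Space n → ℝ} (hψ : Integrable ψ) {t : ℝ} (ht : 0 < t)
    (x : Space n) : |heat t ψ x| ≤ (4 * Real.pi * t) ^ (-(n : ℝ) / 2) * ∫ y, |ψ y| := by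
  refine (abs_heat_le ψ t x).trans ?_
  rw [heat_of_pos ht, ← integral_const_mul]
  exact integral_mono (integrable_gaussKernel_mul hψ.abs ht x) (hψ.abs.const_mul _)
    fun y => mul_le_mul_of_nonneg_right (gaussKernel_le ht _) (abs_nonneg _)

lemma abs_heat_le_of_bounded {ψ : Space n → ℝ} {M : ℝ}
    (hM : ∀ᵐ x, |ψ x| ≤ M) (t : ℝ) : ∀ᵐ x, |heat t ψ x| ≤ M := by
  rcases le_or_gt t 0 with ht | ht
  · rwa [heat_of_nonpos ht]
  · filter_upwards with x
    refine (abs_heat_le ψ t x).trans ?_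
    have h1 : ∫ y : Space n, gaussKernel t (x - y) * M = M := by
      rw [integral_mul_const, integral_sub_left_eq_self (gaussKernel t),
        integral_gaussKernel ht, one_mul]
    rw [heat_of_pos ht, ← h1]
    refine integral_mono_of_nonneg ?_ (((integrable_gaussKernel ht).comp_sub_left x).mul_const M) ?_
    · filter_upwards with y
      exact mul_nonneg (gaussKernel_nonneg t ht.le _) (abs_nonneg _)
    · filter_upwards [hM] with y hy
      exact mul_le_mul_of_nonneg_left hy (gaussKernel_nonneg t ht.le _)

lemma heat_heat {ψ : Space n → ℝ} (hψ : Integrable ψ) {t s : ℝ} (ht : 0 ≤ t) (hs : 0 ≤ s) :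
    heat t (heat s ψ) = heat (t + s) ψ := by
  rcases ht.eq_or_lt with rfl | ht
  · simp [heat_of_nonpos le_rfl]
  rcases hs.eq_or_lt with rfl | hs
  · simp [heat_of_nonpos le_rfl]
  ext x
  rw [heat_of_pos ht, heat_of_pos (by positivity)]
  simp_rw [heat_of_pos hs, ← integral_const_mul]
  rw [integral_integral_swap]
  · congr 1
    ext z
    have h := integral_gaussKernel_mul ht hs (x - z)
    rw [← integral_sub_right_eq_self _ z] at h
    rw [← h, ← integral_mul_const]
    congr 1; ext y
    rw [show x - z - (y - z) = x - y by abel]; ring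
  -- Fubini is justified by replacing the inner kernel with its supremum, which leaves an integrable
  -- product function.
  · have h1 := (((integrable_gaussKernel (n := n) ht).comp_sub_left x).mul_prod
      (hψ.const_mul ((4 * Real.pi * s) ^ (-(n : ℝ) / 2))))
    refine h1.mono ?_ ?_
    · have hψ' : AEStronglyMeasurable (fun z : Space n × Space n => ψ z.2)
        (volume.prod volume) := hψ.aestronglyMeasurable.comp_snd
      have hc1 : Continuous fun z : Space n × Space n => gaussKernel t (x - z.1) :=
        (continuous_gaussKernel t).comp (by fun_prop)
      have hc2 : Continuous fun z : Space n × Space n => gaussKernel s (z.1 - z.2) :=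
        (continuous_gaussKernel s).comp (by fun_prop)
      exact hc1.aestronglyMeasurable.mul (hc2.aestronglyMeasurable.mul hψ')
    · filter_upwards with z
      simp only [Function.uncurry, norm_mul]
      gcongr
      rw [Real.norm_of_nonneg (gaussKernel_nonneg s hs.le _),
        Real.norm_of_nonneg (by positivity)]
      exact gaussKernel_le hs _

/-! ### Approximation by translates -/

/-- `‖a ⋆ b - (∫ a) b‖₁` is controlled by the `L¹` modulus of continuity of `b`. -/
lemma integral_abs_convolution_sub_le {a b : Space n → ℝ} (ha : Integrable a)
    (hb : Integrable b) :
    ∫ x, |(∫ y, a y * b (x - y)) - (∫ y, a y) * b x| ≤ ∫ y, |a y| * ∫ x, |b (x - y) - b x| := by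
  have h1 : Integrable (fun z : Space n × Space n => a z.2 * b (z.1 - z.2))
      (volume.prod volume) := ha.convolution_integrand (ContinuousLinearMap.mul ℝ ℝ) hb
  have h2 : Integrable (fun z : Space n × Space n => a z.2 * b z.1)
      (volume.prod volume) := by
    simpa [mul_comm] using hb.mul_prod ha
  have h3 := (h1.sub h2)
  have h4 : Integrable (fun z : Space n × Space n => |a z.2| * |b (z.1 - z.2) - b z.1|)
      (volume.prod volume) := by
    refine h3.abs.congr ?_
    filter_upwards with z
    simp [← mul_sub, abs_mul]
  have h5 : ∫ y, |a y| * ∫ x, |b (x - y) - b x| = ∫ x, ∫ y, |a y| * |b (x - y) - b x| := by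
    rw [integral_integral_swap (f := fun x y => |a y| * |b (x - y) - b x|) h4]
    simp_rw [integral_const_mul]
  rw [h5]
  refine integral_mono_of_nonneg (by filter_upwards with x; positivity) h4.integral_prod_left ?_
  filter_upwards [h1.prod_right_ae, h2.prod_right_ae] with x hx1 hx2
  rw [← integral_mul_const, ← integral_sub hx1 hx2]
  refine abs_integral_le_integral_abs.trans_eq ?_
  simp_rw [← mul_sub, abs_mul]

/-- The `L¹` modulus of continuity under translations is continuous. -/
lemma continuous_integral_abs_translate_sub {b : Space n → ℝ} (hb : Integrable b) :
    Continuous fun y => ∫ x, |b (x - y) - b x| := by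
  have : Fact ((1 : ℝ≥0∞) ≠ ∞) := ⟨ENNReal.one_ne_top⟩
  set g : L1 n := (memLp_one_iff_integrable.2 hb).toLp b with hg
  -- The modulus is the norm of a translate of the class of b minus that class, and translations act
  -- continuously on L¹.
  have key : ∀ y, ∫ x, |b (x - y) - b x| = ‖(DomAddAct.mk (-y) +ᵥ g) - g‖ := by
    intro y
    rw [L1.norm_eq_integral_norm]
    refine integral_congr_ae ?_
    have hq : (fun x => g (-y + x)) =ᵐ[volume] fun x => b (-y + x) :=
      (measurePreserving_add_left volume (-y)).quasiMeasurePreserving.ae_eq_comp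
        (MemLp.coeFn_toLp _)
    filter_upwards [Lp.coeFn_sub (DomAddAct.mk (-y) +ᵥ g) g,
      DomAddAct.vadd_Lp_ae_eq (DomAddAct.mk (-y)) g, hq,
      MemLp.coeFn_toLp (memLp_one_iff_integrable.2 hb)] with x h1 h2 h3 h4
    rw [h1, Pi.sub_apply, h2, Real.norm_eq_abs]
    simp only [vadd_eq_add, Equiv.symm_apply_apply] at *
    rw [h3, h4, neg_add_eq_sub]
  simp_rw [key]
  have hc : Continuous fun y : Space n => (DomAddAct.mk (-y) : (Space n)ᵈᵃᵃ) :=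
    DomAddAct.continuous_mk.comp continuous_neg
  exact ((hc.vadd continuous_const).sub continuous_const).norm

lemma integral_abs_translate_sub_le {b : Space n → ℝ} (hb : Integrable b) (y : Space n) :
    ∫ x, |b (x - y) - b x| ≤ 2 * ∫ x, |b x| := by
  have h1 : ∫ x, |b (x - y)| = ∫ x, |b x| := integral_sub_right_eq_self (fun x => |b x|) y
  calc ∫ x, |b (x - y) - b x| ≤ ∫ x, (|b (x - y)| + |b x|) :=
        integral_mono ((hb.comp_sub_right y).sub hb).abs ((hb.comp_sub_right y).abs.add hb.abs)
          fun x => abs_sub _ _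
    _ = 2 * ∫ x, |b x| := by
        rw [integral_add (hb.comp_sub_right y).abs hb.abs, h1]; ring

/-! ### Scaling of the Gauss kernel -/

lemma integral_eq_sqrt_pow_mul_integral_smul {t : ℝ} (ht : 0 < t) (F : Space n → ℝ) :
    ∫ x, F x = √t ^ n * ∫ z, F (√t • z) := by
  have hs : 0 < √t := Real.sqrt_pos.2 ht
  rw [Measure.integral_comp_smul, finrank_euclideanSpace, Fintype.card_fin,
    abs_of_pos (by positivity), smul_eq_mul, ← mul_assoc, mul_inv_cancel₀ (by positivity), one_mul]

lemma sqrt_pow_mul_rpow {t : ℝ} (ht : 0 < t) : √t ^ n * t ^ (-(n : ℝ) / 2) = 1 := by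
  rw [Real.sqrt_eq_rpow, ← Real.rpow_natCast, ← Real.rpow_mul ht.le, ← Real.rpow_add ht]
  ring_nf; simp

lemma rpow_neg_half_mul_sqrt {t : ℝ} (ht : 0 < t) : t ^ (-(1 : ℝ) / 2) * √t = 1 := by
  rw [Real.sqrt_eq_rpow, ← Real.rpow_add ht]; norm_num

lemma gaussKernel_sqrt_smul {t : ℝ} (ht : 0 < t) (z : Space n) :
    gaussKernel t (√t • z) = t ^ (-(n : ℝ) / 2) * gaussKernel 1 z := by
  rw [gaussKernel_scale ht, smul_smul, rpow_neg_half_mul_sqrt ht, one_smul]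

lemma integral_gaussKernel_mul_eq {t : ℝ} (ht : 0 < t) (F : Space n → ℝ) :
    ∫ y, gaussKernel t y * F y = ∫ z, gaussKernel 1 z * F (√t • z) := by
  rw [integral_eq_sqrt_pow_mul_integral_smul ht, ← integral_const_mul]
  congr 1; ext z
  rw [gaussKernel_sqrt_smul ht, ← mul_assoc, ← mul_assoc, sqrt_pow_mul_rpow ht, one_mul]

lemma integral_abs_gaussKernel_translate_sub {t : ℝ} (ht : 0 < t) (y : Space n) :
    ∫ x, |gaussKernel t (x - y) - gaussKernel t x| =
      ∫ x, |gaussKernel 1 (x - t ^ (-(1 : ℝ) / 2) • y) - gaussKernel 1 x| := by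
  rw [integral_eq_sqrt_pow_mul_integral_smul ht, ← integral_const_mul]
  congr 1; ext z
  rw [gaussKernel_sqrt_smul ht, gaussKernel_scale ht (_ - y), smul_sub, smul_smul,
    rpow_neg_half_mul_sqrt ht, one_smul, ← mul_sub, abs_mul, ← mul_assoc,
    abs_of_pos (by positivity), sqrt_pow_mul_rpow ht, one_mul]

/-! ### Classes in `L¹` -/

lemma coeFn_toL1 {ψ : Space n → ℝ} (hψ : Integrable ψ) : toL1 ψ =ᵐ[volume] ψ := by
  rw [toL1, dif_pos (memLp_one_iff_integrable.2 hψ)]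
  exact MemLp.coeFn_toLp _

lemma toL1_congr {ψ χ : Space n → ℝ} (h : ψ =ᵐ[volume] χ) : toL1 ψ = toL1 χ := by
  by_cases hψ : MemLp ψ 1 volume
  · rw [toL1, toL1, dif_pos hψ, dif_pos ((memLp_congr_ae h).1 hψ), MemLp.toLp_eq_toLp_iff]
    exact h
  · rw [toL1, toL1, dif_neg hψ, dif_neg (fun h' => hψ ((memLp_congr_ae h).2 h'))]

lemma integrable_L1 (g : L1 n) : Integrable g := L1.integrable_coeFn g

lemma toL1_coeFn (g : L1 n) : toL1 g = g :=
  Lp.ext (coeFn_toL1 (integrable_L1 g))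

lemma norm_eq_integral_abs (g : L1 n) : ‖g‖ = ∫ x, |g x| := L1.norm_eq_integral_norm g

/-- The dictionary between the lattice order of L¹, in which all dominations below are phrased, and
pointwise bounds. -/
lemma L1_abs_le_iff {g h : L1 n} : |g| ≤ h ↔ ∀ᵐ x, |g x| ≤ h x := by
  rw [← Lp.coeFn_le]
  constructor <;> intro H <;> filter_upwards [H, Lp.coeFn_abs g] with x h1 h2
  · rwa [h2] at h1
  · rwa [h2]

/-- Supports the comparison of scalar multiples and of L¹-valued Bochner integrals in the order. -/
instance : IsOrderedModule ℝ (L1 n) :=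
  .of_smul_nonneg fun c hc g hg => by
    rw [← Lp.coeFn_nonneg] at hg ⊢
    filter_upwards [hg, Lp.coeFn_smul c g] with x h1 h2
    rw [h2]
    exact mul_nonneg hc h1

/-! ### The heat semigroup on `L¹` -/

/-- The operator `e^{tΔ}` on `L¹(ℝⁿ)`. -/
noncomputable def heatL1 (t : ℝ) : L1 n →L[ℝ] L1 n :=
  LinearMap.mkContinuous
    { toFun := fun g => toL1 (heat t g)
      map_add' := fun g h => by
        refine Lp.ext ?_
        have hg := integrable_heat (integrable_L1 g) t
        have hh := integrable_heat (integrable_L1 h) t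
        have h1 := heat_congr (Lp.coeFn_add g h) t
        rw [heat_add (integrable_L1 g) (integrable_L1 h)] at h1
        filter_upwards [coeFn_toL1 (integrable_heat (integrable_L1 (g + h)) t), h1,
          Lp.coeFn_add (toL1 (heat t g)) (toL1 (heat t h)), coeFn_toL1 hg, coeFn_toL1 hh]
          with x a1 a2 a3 a4 a5
        rw [a1, a2, a3, Pi.add_apply, Pi.add_apply, a4, a5]
      map_smul' := fun c g => by
        refine Lp.ext ?_
        have hg := integrable_heat (integrable_L1 g) t
        have h1 := heat_congr (Lp.coeFn_smul c g) t
        rw [heat_smul] at h1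
        filter_upwards [coeFn_toL1 (integrable_heat (integrable_L1 (c • g)) t), h1,
          Lp.coeFn_smul c (toL1 (heat t g)), coeFn_toL1 hg] with x a1 a2 a3 a4
        rw [a1, a2, RingHom.id_apply, a3, Pi.smul_apply, Pi.smul_apply, a4] }
    1 fun g => by
      have hg := integrable_heat (integrable_L1 g) t
      simp only [LinearMap.coe_mk, AddHom.coe_mk, one_mul, norm_eq_integral_abs]
      calc ∫ x, |toL1 (heat t g) x| = ∫ x, |heat t g x| :=
            integral_congr_ae (by filter_upwards [coeFn_toL1 hg] with x hx; rw [hx])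
        _ ≤ ∫ x, heat t (fun y => |g y|) x :=
            integral_mono hg.abs (integrable_heat (integrable_L1 g).abs t)
              fun x => abs_heat_le _ t x
        _ = ∫ x, |g x| := integral_heat (integrable_L1 g).abs t

lemma heatL1_apply (t : ℝ) (g : L1 n) : heatL1 t g = toL1 (heat t g) := rfl

lemma coeFn_heatL1 (t : ℝ) (g : L1 n) : heatL1 t g =ᵐ[volume] heat t g :=
  coeFn_toL1 (integrable_heat (integrable_L1 g) t)

lemma toL1_heat {ψ : Space n → ℝ} (hψ : Integrable ψ) (t : ℝ) :
    toL1 (heat t ψ) = heatL1 t (toL1 ψ) :=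
  toL1_congr (heat_congr (coeFn_toL1 hψ).symm t)

lemma norm_heatL1_le (t : ℝ) (g : L1 n) : ‖heatL1 t g‖ ≤ ‖g‖ := by
  simpa using (heatL1 t).le_of_opNorm_le (LinearMap.mkContinuous_norm_le _ zero_le_one _) g

lemma heatL1_of_nonpos {t : ℝ} (ht : t ≤ 0) (g : L1 n) : heatL1 t g = g := by
  rw [heatL1_apply, heat_of_nonpos ht, toL1_coeFn]

/-- Negative times act as the identity, so curves can be taken continuous on all of ℝ. -/
lemma heatL1_max_zero (t : ℝ) (g : L1 n) : heatL1 (max t 0) g = heatL1 t g := by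
  rcases le_or_gt t 0 with ht | ht
  · rw [max_eq_right ht, heatL1_of_nonpos ht, heatL1_of_nonpos le_rfl]
  · rw [max_eq_left ht.le]

lemma heatL1_heatL1 {t s : ℝ} (ht : 0 ≤ t) (hs : 0 ≤ s) (g : L1 n) :
    heatL1 t (heatL1 s g) = heatL1 (t + s) g := by
  rw [heatL1_apply s, ← toL1_heat (integrable_heat (integrable_L1 g) s),
    heat_heat (integrable_L1 g) ht hs, heatL1_apply]

lemma heatL1_nonneg (t : ℝ) {g : L1 n} (hg : 0 ≤ g) : 0 ≤ heatL1 t g := by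
  rw [← Lp.coeFn_nonneg] at hg ⊢
  filter_upwards [coeFn_heatL1 t g, heat_nonneg hg t] with x h1 h2
  rwa [h1]

lemma heatL1_mono (t : ℝ) {g h : L1 n} (hgh : g ≤ h) : heatL1 t g ≤ heatL1 t h := by
  rw [← sub_nonneg, ← map_sub]
  exact heatL1_nonneg t (sub_nonneg.2 hgh)

lemma abs_heatL1_le (t : ℝ) (g : L1 n) : |heatL1 t g| ≤ heatL1 t |g| := by
  refine abs_le'.2 ⟨heatL1_mono t (le_abs_self g), ?_⟩
  rw [← map_neg]
  exact heatL1_mono t (neg_le_abs g)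

lemma integral_heatL1 (t : ℝ) (g : L1 n) : ∫ x, heatL1 t g x = ∫ x, g x := by
  rw [integral_congr_ae (coeFn_heatL1 t g), integral_heat (integrable_L1 g)]

lemma ae_abs_heatL1_le_of_bounded {g : L1 n} {M : ℝ} (h : ∀ᵐ x, |g x| ≤ M) (t : ℝ) :
    ∀ᵐ x, |heatL1 t g x| ≤ M := by
  filter_upwards [coeFn_heatL1 t g, abs_heat_le_of_bounded h t] with x h1 h2
  rwa [h1]

lemma ae_abs_heatL1_le {t : ℝ} (ht : 0 < t) (g : L1 n) :
    ∀ᵐ x, |heatL1 t g x| ≤ (4 * Real.pi * t) ^ (-(n : ℝ) / 2) * ‖g‖ := by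
  filter_upwards [coeFn_heatL1 t g] with x h1
  rw [h1, norm_eq_integral_abs]
  exact abs_heat_le_of_integrable (integrable_L1 g) ht x

/-- G_t has mass one, so e^{tΔ}g - g averages the differences of translates of g. Rescaling to G₁
leaves t only in the shift √t z. -/
lemma norm_heatL1_sub_le (t : ℝ) (g : L1 n) :
    ‖heatL1 t g - g‖ ≤ ∫ z, gaussKernel 1 z * ∫ x, |g (x - √t • z) - g x| := by
  rcases le_or_gt t 0 with ht | ht
  · simp [heatL1_of_nonpos ht, Real.sqrt_eq_zero_of_nonpos ht]
  · rw [← integral_gaussKernel_mul_eq ht (fun y => ∫ x, |g (x - y) - g x|),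
      norm_eq_integral_abs]
    refine Eq.trans_le ?_ ((integral_abs_convolution_sub_le (integrable_gaussKernel ht)
      (integrable_L1 g)).trans_eq ?_)
    · refine integral_congr_ae ?_
      filter_upwards [Lp.coeFn_sub (heatL1 t g) g, coeFn_heatL1 t g] with x h1 h2
      rw [h1, Pi.sub_apply, h2, integral_gaussKernel ht, one_mul, heat_eq_convolution ht,
        convolution_mul]
    · simp_rw [abs_of_nonneg (gaussKernel_nonneg t ht.le _)]

lemma tendsto_heatL1_sub (g : L1 n) :
    Tendsto (fun t => ‖heatL1 t g - g‖) (𝓝 0) (𝓝 0) := by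
  set ω : Space n → ℝ := fun y => ∫ x, |g (x - y) - g x| with hω
  have hωc : Continuous ω := continuous_integral_abs_translate_sub (integrable_L1 g)
  -- The bound is continuous in r = √t by dominated convergence and vanishes at r = 0; since √ is
  -- zero on negatives, the limit is two-sided.
  have hW : Continuous fun r : ℝ => ∫ z, gaussKernel 1 z * ω (r • z) := by
    refine continuous_of_dominated (bound := fun z => gaussKernel 1 z * (2 * ∫ x, |g x|)) ?_ ?_
      ((integrable_gaussKernel one_pos).mul_const _) ?_
    · exact fun r => ((continuous_gaussKernel 1).mul
        (hωc.comp (by fun_prop))).aestronglyMeasurable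
    · intro r
      filter_upwards with z
      have h0 : 0 ≤ ω (r • z) := integral_nonneg fun x => abs_nonneg _
      rw [Real.norm_of_nonneg (mul_nonneg (gaussKernel_nonneg 1 zero_le_one z) h0)]
      exact mul_le_mul_of_nonneg_left (integral_abs_translate_sub_le (integrable_L1 g) _)
        (gaussKernel_nonneg 1 zero_le_one z)
    · filter_upwards with z
      exact continuous_const.mul (hωc.comp (by fun_prop))
  have h0 : Tendsto (fun t : ℝ => ∫ z, gaussKernel 1 z * ω (√t • z)) (𝓝 0) (𝓝 0) := by
    have h := (hW.comp Real.continuous_sqrt).tendsto 0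
    simpa [hω, Function.comp_def] using h
  exact squeeze_zero (fun t => norm_nonneg _) (fun t => norm_heatL1_sub_le t g) h0

/-- The semigroup law and contractivity reduce continuity to time zero. Of the two terms, the one
with nonpositive time is zero; keeping both makes the bound symmetric. -/
lemma norm_heatL1_sub_heatL1_le (t s : ℝ) (g : L1 n) :
    ‖heatL1 t g - heatL1 s g‖ ≤ ‖heatL1 (max t 0 - max s 0) g - g‖ +
      ‖heatL1 (max s 0 - max t 0) g - g‖ := by
  have key : ∀ a b : ℝ, 0 ≤ b → b ≤ a →
      ‖heatL1 a g - heatL1 b g‖ ≤ ‖heatL1 (a - b) g - g‖ := fun a b hb hab => by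
    have : heatL1 a g - heatL1 b g = heatL1 b (heatL1 (a - b) g - g) := by
      rw [map_sub, heatL1_heatL1 hb (sub_nonneg.2 hab)]; congr 2; ring_nf
    rw [this]
    exact norm_heatL1_le _ _
  rw [← heatL1_max_zero t, ← heatL1_max_zero s]
  rcases le_total (max s 0) (max t 0) with h | h
  · exact (key _ _ (le_max_right _ _) h).trans (le_add_of_nonneg_right (norm_nonneg _))
  · rw [norm_sub_rev]
    exact (key _ _ (le_max_right _ _) h).trans (le_add_of_nonneg_left (norm_nonneg _))

lemma continuous_heatL1_apply (g : L1 n) : Continuous fun t => heatL1 t g := by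
  rw [continuous_iff_continuousAt]
  intro s
  rw [ContinuousAt, tendsto_iff_norm_sub_tendsto_zero]
  refine squeeze_zero (fun t => norm_nonneg _) (fun t => norm_heatL1_sub_heatL1_le t s g) ?_
  have h1 : Tendsto (fun t : ℝ => max t 0 - max s 0) (𝓝 s) (𝓝 0) := by
    have : Continuous fun t : ℝ => max t 0 - max s 0 := by fun_prop
    simpa using this.tendsto s
  have h2 : Tendsto (fun t : ℝ => max s 0 - max t 0) (𝓝 s) (𝓝 0) := by
    have : Continuous fun t : ℝ => max s 0 - max t 0 := by fun_prop
    simpa using this.tendsto s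
  have h3 : Tendsto (fun t : ℝ => ‖heatL1 (max t 0 - max s 0) g - g‖) (𝓝 s) (𝓝 0) :=
    (tendsto_heatL1_sub g).comp h1
  have h4 : Tendsto (fun t : ℝ => ‖heatL1 (max s 0 - max t 0) g - g‖) (𝓝 s) (𝓝 0) :=
    (tendsto_heatL1_sub g).comp h2
  simpa using h3.add h4

lemma continuous_heatL1_uncurry : Continuous fun z : ℝ × L1 n => heatL1 z.1 z.2 := by
  rw [continuous_iff_continuousAt]
  rintro ⟨s, g⟩
  rw [ContinuousAt, tendsto_iff_norm_sub_tendsto_zero]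
  have hle : ∀ z : ℝ × L1 n, ‖heatL1 z.1 z.2 - heatL1 s g‖ ≤
      ‖z.2 - g‖ + ‖heatL1 z.1 g - heatL1 s g‖ := fun z => by
    have h : heatL1 z.1 z.2 - heatL1 s g =
        heatL1 z.1 (z.2 - g) + (heatL1 z.1 g - heatL1 s g) := by rw [map_sub]; abel
    rw [h]
    exact (norm_add_le _ _).trans (by gcongr; exact norm_heatL1_le _ _)
  refine squeeze_zero (fun z => norm_nonneg _) hle ?_
  have h : Continuous fun z : ℝ × L1 n => ‖z.2 - g‖ + ‖heatL1 z.1 g - heatL1 s g‖ := by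
    have := (continuous_heatL1_apply g).comp (continuous_fst (X := ℝ) (Y := L1 n))
    fun_prop
  simpa using h.tendsto (s, g)

/-- The heat flow of an integrable function with vanishing mean decays to zero in `L¹`. -/
lemma tendsto_norm_heatL1_of_integral_eq_zero {g : L1 n} (hg : ∫ x, g x = 0) :
    Tendsto (fun t => ‖heatL1 t g‖) atTop (𝓝 0) := by
  set ω : Space n → ℝ := fun y => ∫ x : Space n, |gaussKernel 1 (x - y) - gaussKernel 1 x| with hω
  have hωc : Continuous ω := continuous_integral_abs_translate_sub (integrable_gaussKernel one_pos)
  have hω0 : ∀ y, 0 ≤ ω y := fun y => integral_nonneg fun x => abs_nonneg _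
  have hωle : ∀ y, ω y ≤ 2 := fun y => by
    have := integral_abs_translate_sub_le (integrable_gaussKernel (n := n) one_pos) y
    simp_rw [abs_of_nonneg (gaussKernel_nonneg (n := n) 1 zero_le_one _)] at this
    simpa [integral_gaussKernel] using this
  -- As ∫g = 0, e^{tΔ}g equals g ⋆ G_t - (∫g)G_t, so the modulus of continuity that enters is that
  -- of G_t; by scaling it is the modulus of G₁ at y/√t, which tends to 0.
  have hle : ∀ᶠ t : ℝ in atTop, ‖heatL1 t g‖ ≤ ∫ y, |g y| * ω (t ^ (-(1 : ℝ) / 2) • y) := by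
    filter_upwards [eventually_gt_atTop 0] with t ht
    rw [norm_eq_integral_abs]
    refine Eq.trans_le ?_ ((integral_abs_convolution_sub_le (integrable_L1 g)
      (integrable_gaussKernel ht)).trans_eq ?_)
    · refine integral_congr_ae ?_
      filter_upwards [coeFn_heatL1 t g] with x h2
      rw [hg, zero_mul, sub_zero, h2, heat_of_pos ht]
      simp_rw [mul_comm]
    · simp_rw [integral_abs_gaussKernel_translate_sub ht, hω]
  refine squeeze_zero' (Eventually.of_forall fun t => norm_nonneg _) hle ?_
  have h0 : ∫ y, |g y| * ω ((0 : ℝ) • y) = 0 := by simp [hω]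
  rw [← h0]
  refine tendsto_integral_filter_of_dominated_convergence (fun y => |g y| * 2) ?_ ?_
    ((integrable_L1 g).abs.mul_const 2) ?_
  · filter_upwards with t
    exact (integrable_L1 g).abs.aestronglyMeasurable.mul
      (hωc.comp (by fun_prop)).aestronglyMeasurable
  · filter_upwards with t
    filter_upwards with y
    rw [Real.norm_of_nonneg (mul_nonneg (abs_nonneg _) (hω0 _))]
    exact mul_le_mul_of_nonneg_left (hωle _) (abs_nonneg _)
  · filter_upwards with y
    refine Tendsto.const_mul _ ((hωc.tendsto _).comp ?_)
    refine Tendsto.smul_const ?_ y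
    simpa [neg_div] using tendsto_rpow_neg_atTop (y := 1 / 2) (by norm_num)

/-! ### The nonlinearity as an operator on `L¹` -/

/-- The condition `|f(ξ) - f(η)| ≤ K (|ξ|^{p-1} + |η|^{p-1}) |ξ - η|`, `f(0) = 0`. -/
structure PowerLipschitz (p K : ℝ) (f : ℝ → ℝ) : Prop where
  one_lt : 1 < p
  nonneg : 0 ≤ K
  map_zero : f 0 = 0
  abs_sub_le : ∀ ξ η : ℝ, |f ξ - f η| ≤ K * (|ξ| ^ (p - 1) + |η| ^ (p - 1)) * |ξ - η|

section Nonlinearity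

variable {p K : ℝ} {f : ℝ → ℝ}

lemma PowerLipschitz.abs_le (hf : PowerLipschitz p K f) {M ξ : ℝ} (hξ : |ξ| ≤ M) :
    |f ξ| ≤ K * M ^ (p - 1) * |ξ| := by
  have hp := hf.one_lt
  have h := hf.abs_sub_le ξ 0
  rw [hf.map_zero, sub_zero, sub_zero, abs_zero, Real.zero_rpow (by linarith), add_zero] at h
  refine h.trans ?_
  have := hf.nonneg
  gcongr

lemma PowerLipschitz.abs_sub_le_of_abs_le (hf : PowerLipschitz p K f) {M ξ η : ℝ}
    (hξ : |ξ| ≤ M) (hη : |η| ≤ M) : |f ξ - f η| ≤ 2 * (K * M ^ (p - 1)) * |ξ - η| := by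
  have hp := hf.one_lt
  have := hf.nonneg
  refine (hf.abs_sub_le ξ η).trans ?_
  have h1 : |ξ| ^ (p - 1) ≤ M ^ (p - 1) := by gcongr
  have h2 : |η| ^ (p - 1) ≤ M ^ (p - 1) := by gcongr
  have h3 : K * (|ξ| ^ (p - 1) + |η| ^ (p - 1)) ≤ 2 * (K * M ^ (p - 1)) := by nlinarith
  gcongr

lemma PowerLipschitz.continuous (hf : PowerLipschitz p K f) : Continuous f := by
  rw [continuous_iff_continuousAt]
  intro η
  rw [ContinuousAt, tendsto_iff_norm_sub_tendsto_zero]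
  refine squeeze_zero (fun ξ => norm_nonneg _) (fun ξ => hf.abs_sub_le ξ η) ?_
  have h : Continuous fun ξ : ℝ => K * (|ξ| ^ (p - 1) + |η| ^ (p - 1)) * |ξ - η| := by
    have : Continuous fun ξ : ℝ => |ξ| ^ (p - 1) :=
      continuous_abs.rpow_const fun _ => Or.inr (by linarith [hf.one_lt])
    fun_prop
  simpa using h.tendsto η

/-- The superposition operator `g ↦ f ∘ g` on `L¹`. -/
noncomputable def superposition (f : ℝ → ℝ) (g : L1 n) : L1 n := toL1 fun x => f (g x)

lemma PowerLipschitz.integrable_comp (hf : PowerLipschitz p K f) {g : L1 n} {M : ℝ}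
    (hg : ∀ᵐ x, |g x| ≤ M) : Integrable fun x => f (g x) := by
  refine ((integrable_L1 g).abs.const_mul (K * M ^ (p - 1))).mono'
    (hf.continuous.comp_aestronglyMeasurable (integrable_L1 g).aestronglyMeasurable) ?_
  filter_upwards [hg] with x hx
  exact hf.abs_le hx

lemma PowerLipschitz.coeFn_superposition (hf : PowerLipschitz p K f) {g : L1 n} {M : ℝ}
    (hg : ∀ᵐ x, |g x| ≤ M) : superposition f g =ᵐ[volume] fun x => f (g x) :=
  coeFn_toL1 (hf.integrable_comp hg)

lemma PowerLipschitz.toL1_heat_comp (hf : PowerLipschitz p K f) {g : L1 n} {M : ℝ}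
    (hg : ∀ᵐ x, |g x| ≤ M) (t : ℝ) :
    toL1 (heat t fun x => f (g x)) = heatL1 t (superposition f g) :=
  toL1_heat (hf.integrable_comp hg) t

/-- An order bound keeps the spatial profile |g|, which a norm bound would lose; the heat semigroup
can then act on it. -/
lemma PowerLipschitz.abs_superposition_le (hf : PowerLipschitz p K f) {g : L1 n} {M : ℝ}
    (hg : ∀ᵐ x, |g x| ≤ M) : |superposition f g| ≤ (K * M ^ (p - 1)) • |g| := by
  rw [L1_abs_le_iff]
  filter_upwards [hf.coeFn_superposition hg, hg, Lp.coeFn_smul (K * M ^ (p - 1)) |g|,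
    Lp.coeFn_abs g] with x h1 h2 h3 h4
  rw [h1, h3, Pi.smul_apply, h4, smul_eq_mul]
  exact hf.abs_le h2

lemma PowerLipschitz.norm_superposition_sub_le (hf : PowerLipschitz p K f) {g h : L1 n} {M : ℝ}
    (hg : ∀ᵐ x, |g x| ≤ M) (hh : ∀ᵐ x, |h x| ≤ M) :
    ‖superposition f g - superposition f h‖ ≤ 2 * (K * M ^ (p - 1)) * ‖g - h‖ := by
  rw [norm_eq_integral_abs, norm_eq_integral_abs, ← integral_const_mul]
  refine integral_mono_ae (integrable_L1 _).abs ((integrable_L1 _).abs.const_mul _) ?_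
  filter_upwards [hf.coeFn_superposition hg, hf.coeFn_superposition hh, hg, hh,
    Lp.coeFn_sub g h, Lp.coeFn_sub (superposition f g) (superposition f h)]
    with x h1 h2 h3 h4 h5 h6
  rw [h6, h5, Pi.sub_apply, Pi.sub_apply, h1, h2]
  exact hf.abs_sub_le_of_abs_le h3 h4

/-- Continuity for the L¹ norm, but only on an L^∞ ball: there f is Lipschitz. -/
lemma PowerLipschitz.continuousOn_superposition (hf : PowerLipschitz p K f) (M : ℝ) :
    ContinuousOn (superposition f) {g : L1 n | ∀ᵐ x, |g x| ≤ M} := by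
  refine LipschitzOnWith.continuousOn (K := (2 * (K * M ^ (p - 1))).toNNReal)
    (LipschitzOnWith.of_dist_le_mul ?_)
  intro g hg h hh
  rw [dist_eq_norm, dist_eq_norm]
  exact (hf.norm_superposition_sub_le hg hh).trans
    (mul_le_mul_of_nonneg_right (Real.le_coe_toNNReal _) (norm_nonneg _))

end Nonlinearity

/-! ### Order bounds for Bochner integrals in `L¹` -/

/-- The dominating element P is fixed and only its scalar factor varies, so the integral of the
bound is again a multiple of P. -/
lemma abs_integral_le_smul {X : Type*} [MeasurableSpace X] {μ : Measure X} {h : X → L1 n}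
    {b : X → ℝ} {P : L1 n} (hh : Integrable h μ) (hb : Integrable b μ)
    (H : ∀ᵐ s ∂μ, |h s| ≤ b s • P) : |∫ s, h s ∂μ| ≤ (∫ s, b s ∂μ) • P := by
  rw [← integral_smul_const]
  refine abs_le'.2 ⟨integral_mono_ae hh (hb.smul_const P) ?_, ?_⟩
  · filter_upwards [H] with s hs using (le_abs_self _).trans hs
  · rw [← integral_neg]
    refine integral_mono_ae hh.neg (hb.smul_const P) ?_
    filter_upwards [H] with s hs using (neg_le_abs _).trans hs

lemma abs_intervalIntegral_le_smul {h : ℝ → L1 n} {b : ℝ → ℝ} {P : L1 n} {a t : ℝ} (hat : a ≤ t)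
    (hh : IntervalIntegrable h volume a t) (hb : IntervalIntegrable b volume a t)
    (H : ∀ s ∈ Ioc a t, |h s| ≤ b s • P) :
    |∫ s in a..t, h s| ≤ (∫ s in a..t, b s) • P := by
  rw [intervalIntegral.integral_of_le hat, intervalIntegral.integral_of_le hat]
  rw [intervalIntegrable_iff_integrableOn_Ioc_of_le hat] at hh hb
  exact abs_integral_le_smul hh hb (ae_restrict_of_forall_mem measurableSet_Ioc H)

lemma ae_abs_le_of_abs_le {g P : L1 n} {M : ℝ} (h : |g| ≤ P) (hP : ∀ᵐ x, |P x| ≤ M) :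
    ∀ᵐ x, |g x| ≤ M := by
  filter_upwards [L1_abs_le_iff.1 h, hP] with x h1 h2
  exact h1.trans ((le_abs_self _).trans h2)

/-! ### Existence by a contraction argument -/

/-- The Duhamel map, extended by `φ` to negative times. -/
noncomputable def duhamel (f : ℝ → ℝ) (φ : L1 n) (u : ℝ → L1 n) (t : ℝ) : L1 n :=
  heatL1 t φ + ∫ s in (0 : ℝ)..max t 0, heatL1 (max t 0 - s) (superposition f (u s))

/-- The standing smallness assumptions: twice the heat flow of `|φ|` is bounded by `a`, and
`K a ^ (p - 1)` has a small integral. -/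
structure SmallData (p K : ℝ) (f : ℝ → ℝ) (φ : L1 n) (a : ℝ → ℝ) : Prop where
  powerLipschitz : PowerLipschitz p K f
  continuous : Continuous a
  le_zero : ∀ t, a t ≤ a 0
  nonneg : ∀ t, 0 ≤ a t
  heat_le : ∀ t, ∀ᵐ x, |((2 : ℝ) • heatL1 t (|φ|) : L1 n) x| ≤ a t
  integral_le : ∀ t, 0 ≤ t → ∫ s in (0 : ℝ)..t, K * a s ^ (p - 1) ≤ 1 / 4

/-- `u` is continuous and dominated by twice the heat flow of `|φ|`. -/
structure Dominated (φ : L1 n) (u : ℝ → L1 n) : Prop where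
  continuous : Continuous u
  abs_le : ∀ t, |u t| ≤ (2 : ℝ) • heatL1 t (|φ|)

section Existence

variable {p K : ℝ} {f : ℝ → ℝ} {φ : L1 n} {a : ℝ → ℝ} {u v : ℝ → L1 n}

lemma Dominated.norm_le (hu : Dominated φ u) (t : ℝ) : ‖u t‖ ≤ 2 * ‖φ‖ := by
  have h1 : ‖u t‖ ≤ ‖(2 : ℝ) • heatL1 t (|φ|)‖ :=
    norm_le_norm_of_abs_le_abs ((hu.abs_le t).trans (le_abs_self _))
  rw [norm_smul, Real.norm_ofNat] at h1
  have h2 := norm_heatL1_le t (|φ|)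
  rw [norm_abs_eq_norm] at h2
  linarith

lemma SmallData.ae_abs_le (hd : SmallData p K f φ a) (hu : Dominated φ u) (t : ℝ) :
    ∀ᵐ x, |u t x| ≤ a t :=
  ae_abs_le_of_abs_le (hu.abs_le t) (hd.heat_le t)

lemma SmallData.continuous_weight (hd : SmallData p K f φ a) :
    Continuous fun s => K * a s ^ (p - 1) :=
  continuous_const.mul (hd.continuous.rpow_const fun _ =>
    Or.inr (by linarith [hd.powerLipschitz.one_lt]))

lemma SmallData.weight_nonneg (hd : SmallData p K f φ a) (s : ℝ) : 0 ≤ K * a s ^ (p - 1) :=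
  mul_nonneg hd.powerLipschitz.nonneg (Real.rpow_nonneg (hd.nonneg s) _)

lemma SmallData.continuous_superposition (hd : SmallData p K f φ a) (hu : Dominated φ u) :
    Continuous fun s => superposition f (u s) := by
  refine (hd.powerLipschitz.continuousOn_superposition (a 0)).comp_continuous hu.continuous ?_
  intro s
  filter_upwards [hd.ae_abs_le hu s] with x hx using hx.trans (hd.le_zero s)

lemma SmallData.continuous_integrand (hd : SmallData p K f φ a) (hu : Dominated φ u) :
    Continuous fun z : ℝ × ℝ => heatL1 (z.1 - z.2) (superposition f (u z.2)) :=
  continuous_heatL1_uncurry.comp ((continuous_fst.sub continuous_snd).prodMk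
    ((hd.continuous_superposition hu).comp continuous_snd))

lemma SmallData.intervalIntegrable_integrand (hd : SmallData p K f φ a) (hu : Dominated φ u)
    (t c d : ℝ) :
    IntervalIntegrable (fun s => heatL1 (t - s) (superposition f (u s))) volume c d :=
  ((hd.continuous_integrand hu).comp (continuous_const.prodMk continuous_id)).intervalIntegrable
    c d

lemma SmallData.continuous_duhamel (hd : SmallData p K f φ a) (hu : Dominated φ u) :
    Continuous (duhamel f φ u) := by
  have h : Continuous fun t => ∫ s in (0 : ℝ)..t, heatL1 (t - s) (superposition f (u s)) :=
    intervalIntegral.continuous_parametric_intervalIntegral_of_continuous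
      (hd.continuous_integrand hu) continuous_id
  exact (continuous_heatL1_apply φ).add (h.comp (continuous_id.max continuous_const))

lemma SmallData.abs_superposition_le (hd : SmallData p K f φ a) (hu : Dominated φ u) (s : ℝ) :
    |superposition f (u s)| ≤ (2 * (K * a s ^ (p - 1))) • heatL1 s (|φ|) := by
  refine (hd.powerLipschitz.abs_superposition_le (hd.ae_abs_le hu s)).trans ?_
  refine (smul_le_smul_of_nonneg_left (hu.abs_le s) (hd.weight_nonneg s)).trans_eq ?_
  rw [smul_smul, mul_comm]

/-- The decisive estimate: e^{(t-s)Δ}e^{sΔ}|φ| = e^{tΔ}|φ| no longer depends on s, so the Duhamel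
integral reduces to a scalar integral, without singularity at s = t. -/
lemma SmallData.abs_integrand_le (hd : SmallData p K f φ a) (hu : Dominated φ u) {s t : ℝ}
    (hs : 0 ≤ s) (hst : s ≤ t) :
    |heatL1 (t - s) (superposition f (u s))| ≤ (2 * (K * a s ^ (p - 1))) • heatL1 t (|φ|) := by
  refine (abs_heatL1_le _ _).trans ((heatL1_mono _ (hd.abs_superposition_le hu s)).trans_eq ?_)
  rw [map_smul, heatL1_heatL1 (sub_nonneg.2 hst) hs, sub_add_cancel]

lemma SmallData.abs_integral_integrand_le (hd : SmallData p K f φ a) (hu : Dominated φ u)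
    {T t : ℝ} (hT : 0 ≤ T) (hTt : T ≤ t) :
    |∫ s in T..t, heatL1 (t - s) (superposition f (u s))| ≤
      (2 * ∫ s in T..t, K * a s ^ (p - 1)) • heatL1 t (|φ|) := by
  rw [← intervalIntegral.integral_const_mul]
  exact abs_intervalIntegral_le_smul hTt (hd.intervalIntegrable_integrand hu t T t)
    ((continuous_const.mul hd.continuous_weight).intervalIntegrable _ _)
    fun s hs => hd.abs_integrand_le hu (hT.trans hs.1.le) hs.2

/-- The linear part costs one copy of e^{tΔ}|φ| and the integral at most half a copy, which fits
into the factor 2. -/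
lemma SmallData.dominated_duhamel (hd : SmallData p K f φ a) (hu : Dominated φ u) :
    Dominated φ (duhamel f φ u) := by
  refine ⟨hd.continuous_duhamel hu, fun t => ?_⟩
  have h1 := hd.abs_integral_integrand_le hu le_rfl (le_max_right t 0)
  have h2 := hd.integral_le (max t 0) (le_max_right t 0)
  have h3 : 0 ≤ heatL1 t (|φ|) := heatL1_nonneg t (abs_nonneg φ)
  rw [heatL1_max_zero] at h1
  refine (abs_add_le _ _).trans ((add_le_add (abs_heatL1_le t φ) (h1.trans
    (smul_le_smul_of_nonneg_right (by linarith : _ ≤ (1 : ℝ)) h3))).trans_eq ?_)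
  rw [one_smul, two_smul]

/-- The local Lipschitz constant is 2K a(s)^{p-1}, whose integral is at most 2 · 1/4. -/
lemma SmallData.norm_duhamel_sub_le (hd : SmallData p K f φ a) (hu : Dominated φ u)
    (hv : Dominated φ v) {D : ℝ} (hD : ∀ s, ‖u s - v s‖ ≤ D) (t : ℝ) :
    ‖duhamel f φ u t - duhamel f φ v t‖ ≤ 1 / 2 * D := by
  have hD0 : 0 ≤ D := (norm_nonneg _).trans (hD 0)
  have ht : 0 ≤ max t 0 := le_max_right t 0
  rw [duhamel, duhamel, add_sub_add_left_eq_sub, ← intervalIntegral.integral_sub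
    (hd.intervalIntegrable_integrand hu _ _ _) (hd.intervalIntegrable_integrand hv _ _ _)]
  calc _ ≤ ∫ s in (0 : ℝ)..max t 0, 2 * D * (K * a s ^ (p - 1)) := by
        refine intervalIntegral.norm_integral_le_of_norm_le ht ?_
          ((continuous_const.mul hd.continuous_weight).intervalIntegrable _ _)
        filter_upwards with s hs
        rw [← map_sub]
        refine (norm_heatL1_le _ _).trans ((hd.powerLipschitz.norm_superposition_sub_le
          (hd.ae_abs_le hu s) (hd.ae_abs_le hv s)).trans ?_)
        have := hd.weight_nonneg s
        nlinarith [hD s, mul_le_mul_of_nonneg_left (hD s) this]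
    _ ≤ 2 * D * (1 / 4) := by
        rw [intervalIntegral.integral_const_mul]
        exact mul_le_mul_of_nonneg_left (hd.integral_le _ ht) (by positivity)
    _ = 1 / 2 * D := by ring

open BoundedContinuousFunction in
/-- The Duhamel map has a fixed point dominated by the heat flow of `|φ|`. -/
theorem SmallData.exists_fixedPoint (hd : SmallData p K f φ a) :
    ∃ u : ℝ → L1 n, Dominated φ u ∧ duhamel f φ u = u := by
  -- Only sup_t ‖·‖₁ is used as metric: the L^∞ control sits in the order constraint, which is
  -- closed in L¹.
  let B : Set (ℝ →ᵇ L1 n) := {u | ∀ t, |u t| ≤ (2 : ℝ) • heatL1 t (|φ|)}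
  have hB : IsClosed B := by
    have : B = ⋂ t, {u : ℝ →ᵇ L1 n | u t ≤ (2 : ℝ) • heatL1 t (|φ|)} ∩
        {u : ℝ →ᵇ L1 n | -u t ≤ (2 : ℝ) • heatL1 t (|φ|)} := by
      ext u
      simp [B, abs_le']
    rw [this]
    refine isClosed_iInter fun t => IsClosed.inter ?_ ?_
    · exact isClosed_le (continuous_eval_const t) continuous_const
    · exact isClosed_le (continuous_eval_const t).neg continuous_const
  have hdom : ∀ u : B, Dominated φ u.1 := fun u => ⟨u.1.continuous, u.2⟩
  have hbound : ∀ u : B, ∀ t, ‖duhamel f φ u.1 t‖ ≤ 2 * ‖φ‖ := fun u =>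
    (hd.dominated_duhamel (hdom u)).norm_le
  let Φ : B → B := fun u =>
    ⟨ofNormedAddCommGroup (duhamel f φ u.1) (hd.continuous_duhamel (hdom u)) _ (hbound u),
      (hd.dominated_duhamel (hdom u)).abs_le⟩
  have : CompleteSpace B := hB.completeSpace_coe
  have : Nonempty B := ⟨⟨0, fun t => by
    have h3 : 0 ≤ heatL1 t (|φ|) := heatL1_nonneg t (abs_nonneg φ)
    simpa using smul_nonneg zero_le_two h3⟩⟩
  have hΦ : ContractingWith (1 / 2) Φ := by
    refine ⟨by rw [← NNReal.coe_lt_coe]; norm_num, LipschitzWith.of_dist_le_mul fun u v => ?_⟩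
    rw [Subtype.dist_eq]
    refine (dist_le (by positivity)).2 fun t => ?_
    rw [dist_eq_norm]
    have := hd.norm_duhamel_sub_le (hdom u) (hdom v) (D := dist u v)
      (fun s => by rw [← dist_eq_norm]; exact dist_coe_le_dist s) t
    exact this.trans_eq (by norm_num)
  refine ⟨(hΦ.fixedPoint Φ).1, hdom _, ?_⟩
  have h := hΦ.fixedPoint_isFixedPt
  ext1 t
  exact congrArg (fun w : B => w.1 t) h

end Existence

/-! ### Norm estimates -/

lemma eLpNorm_top_le_ofReal {g : Space n → ℝ} {M : ℝ} (h : ∀ᵐ x, |g x| ≤ M) :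
    eLpNorm g ∞ volume ≤ ENNReal.ofReal M := by
  rw [eLpNorm_exponent_top]
  exact eLpNormEssSup_le_of_ae_bound h

lemma ae_abs_le_of_eLpNorm_top_le {g : Space n → ℝ} {M : ℝ≥0}
    (h : eLpNorm g ∞ volume ≤ M) : ∀ᵐ x, |g x| ≤ M := by
  rw [eLpNorm_exponent_top] at h
  filter_upwards [ae_le_eLpNormEssSup (f := g) (μ := volume)] with x hx
  have := hx.trans h
  rw [enorm_le_coe, ← NNReal.coe_le_coe, coe_nnnorm] at this
  exact this

lemma eLpNorm_one_coeFn (g : L1 n) : eLpNorm g 1 volume = ENNReal.ofReal ‖g‖ := by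
  rw [Lp.norm_def, ENNReal.ofReal_toReal (Lp.eLpNorm_ne_top g)]

/-- Interpolation between `L¹` and `L^∞`, with the weights of the heat flow. -/
lemma ofReal_rpow_mul_eLpNorm_le {g : Space n → ℝ} {t : ℝ} {A q : ℝ≥0∞} (ht : 0 < t)
    (h1 : eLpNorm g 1 volume ≤ A)
    (h2 : ENNReal.ofReal (t ^ ((n : ℝ) / 2)) * eLpNorm g ∞ volume ≤ A) (hq : 1 ≤ q) :
    ENNReal.ofReal (t ^ decayExponent n q) * eLpNorm g q volume ≤ A := by
  rcases eq_or_ne q ∞ with rfl | hq'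
  · simpa [decayExponent] using h2
  set r := q.toReal with hr
  have hr1 : 1 ≤ r := by
    rw [hr, ← ENNReal.toReal_one]; exact ENNReal.toReal_mono hq' hq
  have hr0 : 0 < r := by linarith
  set N := eLpNorm g ∞ volume
  rcases eq_or_ne A ∞ with rfl | hA
  · exact le_top
  -- The weight t^{n/2} is positive, so finiteness of A forces N finite; then |g|^r ≤ N^{r-1}|g| can
  -- be integrated.
  have hN : N ≠ ∞ := by
    intro hN
    rw [hN, ENNReal.mul_top (by simpa using Real.rpow_pos_of_pos ht _)] at h2
    exact hA (top_le_iff.1 h2)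
  have hint : ∫⁻ x, ‖g x‖ₑ ^ r ≤ N ^ (r - 1) * eLpNorm g 1 volume := by
    rw [eLpNorm_one_eq_lintegral_enorm]
    rw [← lintegral_const_mul' _ _ (ENNReal.rpow_ne_top_of_nonneg (by linarith) hN)]
    refine lintegral_mono_ae ?_
    filter_upwards [ae_le_eLpNormEssSup (f := g) (μ := volume)] with x hx
    calc ‖g x‖ₑ ^ r = ‖g x‖ₑ ^ (r - 1) * ‖g x‖ₑ := by
          conv_lhs => rw [show r = (r - 1) + 1 by ring,
            ENNReal.rpow_add_of_nonneg _ _ (by linarith) zero_le_one, ENNReal.rpow_one]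
      _ ≤ N ^ (r - 1) * ‖g x‖ₑ := by
          gcongr
          exact hx
  have hd : t ^ decayExponent n q = (t ^ ((n : ℝ) / 2)) ^ (1 - 1 / r) := by
    rw [← Real.rpow_mul ht.le, decayExponent]; simp [hr]
  have hr2 : 0 ≤ 1 - 1 / r := by
    rw [sub_nonneg, div_le_one hr0]; exact hr1
  have hN' : (N ^ (r - 1)) ^ (1 / r) = N ^ (1 - 1 / r) := by
    rw [← ENNReal.rpow_mul]; congr 1; field_simp
  rw [eLpNorm_eq_lintegral_rpow_enorm_toReal (by positivity) hq', ← hr, hd,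
    ← ENNReal.ofReal_rpow_of_nonneg (by positivity) hr2]
  calc _ ≤ ENNReal.ofReal (t ^ ((n : ℝ) / 2)) ^ (1 - 1 / r) *
        (N ^ (r - 1) * eLpNorm g 1 volume) ^ (1 / r) := by gcongr
    _ = (ENNReal.ofReal (t ^ ((n : ℝ) / 2)) * N) ^ (1 - 1 / r) *
        eLpNorm g 1 volume ^ (1 / r) := by
        rw [ENNReal.mul_rpow_of_nonneg _ _ (by positivity), hN',
          ENNReal.mul_rpow_of_nonneg _ _ hr2, mul_assoc]
    _ ≤ A ^ (1 - 1 / r) * A ^ (1 / r) := by gcongr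
    _ = A := by
        rw [← ENNReal.rpow_add_of_nonneg _ _ hr2 (by positivity)]; simp

/-! ### Uniqueness -/

/-- Gronwall applied to the primitive of D, since D itself is merely continuous. Freezing D at
negative times makes the primitive differentiable everywhere. -/
lemma eqOn_zero_of_le_integral {D : ℝ → ℝ} {L : ℝ} (hc : ContinuousOn D (Ici 0))
    (h0 : ∀ t, 0 ≤ t → 0 ≤ D t) (hL : 0 ≤ L)
    (h : ∀ t, 0 ≤ t → D t ≤ L * ∫ s in (0 : ℝ)..t, D s) {t : ℝ} (ht : 0 ≤ t) : D t = 0 := by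
  set D' : ℝ → ℝ := fun s => D (max s 0) with hD'
  have hc' : Continuous D' :=
    hc.comp_continuous (continuous_id.max continuous_const) fun s => le_max_right s 0
  have hint : ∀ t, 0 ≤ t → ∫ s in (0 : ℝ)..t, D s = ∫ s in (0 : ℝ)..t, D' s := fun t ht => by
    refine intervalIntegral.integral_congr fun s hs => ?_
    rw [uIcc_of_le ht] at hs
    simp [hD', max_eq_left hs.1]
  have hE : ∀ t, HasDerivAt (fun t => ∫ s in (0 : ℝ)..t, D' s) (D' t) t := fun t =>
    (hc'.integral_hasStrictDerivAt 0 t).hasDerivAt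
  have hpos : ∀ t, 0 ≤ t → 0 ≤ ∫ s in (0 : ℝ)..t, D' s := fun t ht =>
    intervalIntegral.integral_nonneg ht fun s _ => h0 _ (le_max_right s 0)
  have hg := norm_le_gronwallBound_of_norm_deriv_right_le (δ := 0) (K := L) (ε := 0) (a := 0)
    (b := t) (f := fun t => ∫ s in (0 : ℝ)..t, D' s) (f' := D')
    (fun s _ => (hE s).continuousAt.continuousWithinAt) (fun s _ => (hE s).hasDerivWithinAt)
    (by simp) (fun s hs => by
      rw [Real.norm_of_nonneg (h0 _ (le_max_right s 0)), Real.norm_of_nonneg (hpos s hs.1),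
        add_zero, ← hint s hs.1, max_eq_left hs.1]
      exact h s hs.1) t ⟨ht, le_rfl⟩
  rw [gronwallBound_ε0_δ0, Real.norm_of_nonneg (hpos t ht), ← hint t ht] at hg
  have := h t ht
  have h' := h0 t ht
  nlinarith

lemma MemX.exists_ae_abs_le {u : ℝ → L1 n} (hu : MemX u) :
    ∃ M : ℝ, 0 ≤ M ∧ ∀ t, 0 < t → ∀ᵐ x, |u t x| ≤ M := by
  obtain ⟨M, hM⟩ := hu.bounded_Linfty
  exact ⟨M, M.2, fun t ht => ae_abs_le_of_eLpNorm_top_le (hM t ht)⟩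

/-- Uniqueness of global solutions in the class `X`. -/
theorem IsGlobalSolution.eqOn {p K : ℝ} {f : ℝ → ℝ} (hf : PowerLipschitz p K f)
    {φ : Space n → ℝ} {u v : ℝ → L1 n} (hu : IsGlobalSolution f φ u)
    (hv : IsGlobalSolution f φ v) : EqOn v u (Ici 0) := by
  obtain ⟨M₁, hM₁, hu1⟩ := hu.memX.exists_ae_abs_le
  obtain ⟨M₂, hM₂, hv1⟩ := hv.memX.exists_ae_abs_le
  set M := max M₁ M₂
  set L := 2 * (K * M ^ (p - 1))
  have hM : 0 ≤ M := hM₁.trans (le_max_left _ _)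
  have hL : 0 ≤ L := by have := hf.nonneg; positivity
  have hu2 : ∀ t, 0 < t → ∀ᵐ x, |u t x| ≤ M := fun t ht => by
    filter_upwards [hu1 t ht] with x hx using hx.trans (le_max_left _ _)
  have hv2 : ∀ t, 0 < t → ∀ᵐ x, |v t x| ≤ M := fun t ht => by
    filter_upwards [hv1 t ht] with x hx using hx.trans (le_max_right _ _)
  have hc : ContinuousOn (fun t => ‖v t - u t‖) (Ici 0) :=
    (hv.memX.continuousOn_L1.sub hu.memX.continuousOn_L1).norm
  intro t ht
  rw [← sub_eq_zero, ← norm_eq_zero]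
  refine eqOn_zero_of_le_integral hc (fun _ _ => norm_nonneg _) hL ?_ ht
  intro t ht
  rw [hu.integral_equation t ht, hv.integral_equation t ht, add_sub_add_left_eq_sub,
    ← intervalIntegral.integral_sub (hv.integrable t ht) (hu.integrable t ht),
    ← intervalIntegral.integral_const_mul]
  -- Bounds are required on (0,t] only, matching the class X, which gives no L^∞ bound at time 0.
  refine intervalIntegral.norm_integral_le_of_norm_le ht ?_ ?_
  · filter_upwards with s hs
    rw [hf.toL1_heat_comp (hu2 s hs.1), hf.toL1_heat_comp (hv2 s hs.1), ← map_sub]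
    exact (norm_heatL1_le _ _).trans (hf.norm_superposition_sub_le (hv2 s hs.1) (hu2 s hs.1))
  · refine ContinuousOn.intervalIntegrable ?_
    rw [uIcc_of_le ht]
    exact continuousOn_const.mul (hc.mono Icc_subset_Ici_self)

/-! ### The fixed point is a global solution -/

section Solution

variable {p K : ℝ} {f : ℝ → ℝ} {φ : L1 n} {a : ℝ → ℝ} {u : ℝ → L1 n}

lemma eq_of_duhamel_eq (hfix : duhamel f φ u = u) {t : ℝ} (ht : 0 ≤ t) :
    u t = heatL1 t φ + ∫ s in (0 : ℝ)..t, heatL1 (t - s) (superposition f (u s)) := by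
  conv_lhs => rw [← hfix, duhamel, max_eq_left ht]

/-- The operator e^{(t-T)Δ} passes through the integral over [0,T] and merges with e^{(T-s)Δ}. -/
lemma SmallData.eq_restart (hd : SmallData p K f φ a) (hu : Dominated φ u)
    (hfix : duhamel f φ u = u) {T t : ℝ} (hT : 0 ≤ T) (hTt : T ≤ t) :
    u t = heatL1 (t - T) (u T) +
      ∫ s in T..t, heatL1 (t - s) (superposition f (u s)) := by
  have h := hd.intervalIntegrable_integrand hu
  rw [eq_of_duhamel_eq hfix (hT.trans hTt), eq_of_duhamel_eq hfix hT, map_add,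
    heatL1_heatL1 (sub_nonneg.2 hTt) hT, sub_add_cancel, add_assoc,
    ← ContinuousLinearMap.intervalIntegral_comp_comm _ (h T 0 T)]
  have h1 : ∫ s in (0 : ℝ)..T, heatL1 (t - T) (heatL1 (T - s) (superposition f (u s))) =
      ∫ s in (0 : ℝ)..T, heatL1 (t - s) (superposition f (u s)) := by
    refine intervalIntegral.integral_congr fun s hs => ?_
    rw [uIcc_of_le hT] at hs
    rw [heatL1_heatL1 (sub_nonneg.2 hTt) (sub_nonneg.2 hs.2)]
    congr 2; ring
  rw [h1, intervalIntegral.integral_add_adjacent_intervals (h t 0 T) (h t T t)]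

lemma SmallData.abs_sub_restart_le (hd : SmallData p K f φ a) (hu : Dominated φ u)
    (hfix : duhamel f φ u = u) {T t : ℝ} (hT : 0 ≤ T) (hTt : T ≤ t) :
    |u t - heatL1 (t - T) (u T)| ≤ (2 * ∫ s in T..t, K * a s ^ (p - 1)) • heatL1 t (|φ|) := by
  rw [hd.eq_restart hu hfix hT hTt, add_sub_cancel_left]
  exact hd.abs_integral_integrand_le hu hT hTt

/-- Spending time δ/2 on L¹–L^∞ smoothing turns the L¹ continuity of the flow into L^∞ continuity.
-/
lemma eventually_ae_abs_heatL1_sub_le (g : L1 n) {δ ε : ℝ} (hδ : 0 < δ) (hε : 0 < ε) :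
    ∀ᶠ s in 𝓝 δ, ∀ᵐ x, |(heatL1 s g - heatL1 δ g) x| ≤ ε := by
  set C := (4 * Real.pi * (δ / 2)) ^ (-(n : ℝ) / 2)
  have h : Continuous fun s => C * ‖heatL1 (s - δ / 2) g - heatL1 (δ / 2) g‖ := by
    have := (continuous_heatL1_apply g).comp (continuous_id.sub (continuous_const (y := δ / 2)))
    exact continuous_const.mul ((this.sub continuous_const).norm)
  have h0 : C * ‖heatL1 (δ - δ / 2) g - heatL1 (δ / 2) g‖ < ε := by
    rw [sub_half, sub_self, norm_zero, mul_zero]; exact hε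
  filter_upwards [h.continuousAt.eventually_lt_const h0,
    eventually_gt_nhds (half_lt_self hδ)] with s hs hs'
  have h1 : heatL1 s g - heatL1 δ g =
      heatL1 (δ / 2) (heatL1 (s - δ / 2) g - heatL1 (δ / 2) g) := by
    rw [map_sub, heatL1_heatL1 (by positivity) (by linarith),
      heatL1_heatL1 (by positivity) (by positivity), add_sub_cancel, add_halves]
  rw [h1]
  filter_upwards [ae_abs_heatL1_le (half_pos hδ) (heatL1 (s - δ / 2) g - heatL1 (δ / 2) g)]
    with x hx using hx.trans hs.le

lemma SmallData.ae_abs_sub_restart_le (hd : SmallData p K f φ a) (hu : Dominated φ u)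
    (hfix : duhamel f φ u = u) {T t : ℝ} (hT : 0 ≤ T) (hTt : T ≤ t) :
    ∀ᵐ x, |(u t - heatL1 (t - T) (u T)) x| ≤ (t - T) * (K * a 0 ^ (p - 1)) * a 0 := by
  have h1 := hd.abs_sub_restart_le hu hfix hT hTt
  have hK := hd.powerLipschitz.nonneg
  have hp := hd.powerLipschitz.one_lt
  have h2 : ∫ s in T..t, K * a s ^ (p - 1) ≤ (t - T) * (K * a 0 ^ (p - 1)) := by
    rw [← smul_eq_mul, ← intervalIntegral.integral_const]
    refine intervalIntegral.integral_mono_on hTt (hd.continuous_weight.intervalIntegrable _ _)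
      intervalIntegrable_const fun s _ => ?_
    have := hd.nonneg s
    have := hd.le_zero s
    gcongr
  have h3 : (0 : ℝ) ≤ ∫ s in T..t, K * a s ^ (p - 1) :=
    intervalIntegral.integral_nonneg hTt fun s _ => hd.weight_nonneg s
  have h4 : (0 : L1 n) ≤ (2 : ℝ) • heatL1 t (|φ|) :=
    smul_nonneg zero_le_two (heatL1_nonneg t (abs_nonneg φ))
  -- The factor 2 is regrouped with the heat flow because `heat_le` bounds the doubled flow.
  rw [mul_comm 2, mul_smul, L1_abs_le_iff] at h1
  filter_upwards [h1, hd.heat_le t, Lp.coeFn_smul (∫ s in T..t, K * a s ^ (p - 1))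
    ((2 : ℝ) • heatL1 t (|φ|)), (Lp.coeFn_nonneg _).2 h4] with x h4 h5 h6 h7
  rw [h6, Pi.smul_apply, smul_eq_mul] at h4
  exact h4.trans (mul_le_mul h2 ((le_abs_self _).trans (h5.trans (hd.le_zero t))) h7
    (h3.trans h2))

lemma SmallData.memX (hd : SmallData p K f φ a) (hu : Dominated φ u)
    (hfix : duhamel f φ u = u) : MemX u where
  continuousOn_L1 := hu.continuous.continuousOn
  bounded_L1 := ⟨2 * ‖φ‖, fun t _ => hu.norm_le t⟩
  bounded_Linfty := by
    refine ⟨(a 0).toNNReal, fun t _ => eLpNorm_top_le_ofReal ?_⟩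
    filter_upwards [hd.ae_abs_le hu t] with x hx using hx.trans (hd.le_zero t)
  continuous_Linfty := by
    intro t ht
    set c := (K * a 0 ^ (p - 1)) * a 0 with hc
    have hc0 : 0 ≤ c := mul_nonneg (hd.weight_nonneg 0) (hd.nonneg 0)
    rw [ENNReal.tendsto_nhds_zero]
    intro ε hε
    obtain ⟨e, he, heε⟩ : ∃ e : ℝ, 0 < e ∧ ENNReal.ofReal e ≤ ε := by
      rcases eq_or_ne ε ∞ with rfl | h
      · exact ⟨1, one_pos, le_top⟩
      · exact ⟨ε.toReal, ENNReal.toReal_pos hε.ne' h, ENNReal.ofReal_toReal_le⟩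
    -- Both u(s) and u(t) are compared with the free flow started at t - δ. The Duhamel errors are
    -- at most 2δc and δc, since s - (t - δ) < 2δ; the other e/2 pays for the continuity of the free
    -- flow.
    obtain ⟨δ, hδ, hδt, hδc⟩ : ∃ δ : ℝ, 0 < δ ∧ δ ≤ t ∧ 3 * δ * c ≤ e / 2 := by
      refine ⟨min t (e / (6 * (c + 1))), by positivity, min_le_left _ _, ?_⟩
      have : min t (e / (6 * (c + 1))) ≤ e / (6 * (c + 1)) := min_le_right _ _
      calc 3 * min t (e / (6 * (c + 1))) * c ≤ 3 * (e / (6 * (c + 1))) * (c + 1) := by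
            gcongr; linarith
        _ = e / 2 := by field_simp; norm_num
    have hT : 0 ≤ t - δ := by linarith
    have hmid : ∀ᶠ s in 𝓝 t, ∀ᵐ x,
        |(heatL1 (s - (t - δ)) (u (t - δ)) - heatL1 δ (u (t - δ))) x| ≤ e / 2 := by
      have h : Tendsto (fun s => s - (t - δ)) (𝓝 t) (𝓝 δ) := by
        have : Continuous fun s : ℝ => s - (t - δ) := by fun_prop
        simpa using this.tendsto t
      exact h.eventually (eventually_ae_abs_heatL1_sub_le (u (t - δ)) hδ (half_pos he))
    filter_upwards [hmid, eventually_gt_nhds (sub_lt_self t hδ),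
      eventually_lt_nhds (lt_add_of_pos_right t hδ)] with s h1 h2 h3
    refine le_trans (eLpNorm_top_le_ofReal (M := e) ?_) heε
    filter_upwards [h1, hd.ae_abs_sub_restart_le hu hfix hT h2.le,
      hd.ae_abs_sub_restart_le hu hfix hT (sub_le_self t hδ.le),
      Lp.coeFn_sub (heatL1 (s - (t - δ)) (u (t - δ))) (heatL1 δ (u (t - δ))),
      Lp.coeFn_sub (u s) (heatL1 (s - (t - δ)) (u (t - δ))),
      Lp.coeFn_sub (u t) (heatL1 (t - (t - δ)) (u (t - δ)))] with x a1 a2 a3 a4 a5 a6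
    rw [a4] at a1
    rw [a5, mul_assoc, ← hc] at a2
    rw [a6, sub_sub_cancel, mul_assoc, ← hc] at a3
    simp only [Pi.sub_apply] at a1 a2 a3 ⊢
    have : (s - (t - δ)) * c ≤ 2 * δ * c := by gcongr; linarith
    rw [abs_le] at a1 a2 a3 ⊢
    constructor <;> linarith

lemma SmallData.isGlobalSolution (hd : SmallData p K f φ a) (hu : Dominated φ u)
    (hfix : duhamel f φ u = u) {φ' : Space n → ℝ} (hφ' : Integrable φ') (h : toL1 φ' = φ) :
    IsGlobalSolution f φ' u := by
  have key : ∀ t s, toL1 (heat (t - s) fun x => f (u s x)) =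
      heatL1 (t - s) (superposition f (u s)) := fun t s =>
    hd.powerLipschitz.toL1_heat_comp (hd.ae_abs_le hu s) _
  refine ⟨hd.memX hu hfix, fun t _ => ?_, fun t ht => ?_⟩
  · simp_rw [key]
    exact hd.intervalIntegrable_integrand hu t 0 t
  · simp_rw [key]
    rw [toL1_heat hφ', h]
    exact eq_of_duhamel_eq hfix ht

end Solution

/-! ### Large time behaviour -/

/-- `‖g‖₁ ≤ ε` and `t^{n/2} ‖g‖_∞ ≤ ε`. -/
def HeatSmall (t ε : ℝ) (g : L1 n) : Prop :=
  ‖g‖ ≤ ε ∧ ∀ᵐ x, |g x| ≤ ε * t ^ (-(n : ℝ) / 2)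

lemma HeatSmall.add {t ε δ : ℝ} {g h : L1 n} (hg : HeatSmall t ε g) (hh : HeatSmall t δ h) :
    HeatSmall t (ε + δ) (g + h) := by
  refine ⟨(norm_add_le _ _).trans (add_le_add hg.1 hh.1), ?_⟩
  filter_upwards [Lp.coeFn_add g h, hg.2, hh.2] with x h1 h2 h3
  rw [h1, Pi.add_apply, add_mul]
  exact (abs_add_le _ _).trans (add_le_add h2 h3)

lemma HeatSmall.smul {t ε : ℝ} {g : L1 n} (c : ℝ) (hg : HeatSmall t ε g) :
    HeatSmall t (|c| * ε) (c • g) := by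
  refine ⟨?_, ?_⟩
  · rw [norm_smul, Real.norm_eq_abs]
    exact mul_le_mul_of_nonneg_left hg.1 (abs_nonneg c)
  · filter_upwards [Lp.coeFn_smul c g, hg.2] with x h1 h2
    rw [h1, Pi.smul_apply, smul_eq_mul, abs_mul, mul_assoc]
    exact mul_le_mul_of_nonneg_left h2 (abs_nonneg c)

lemma HeatSmall.of_abs_le {t ε : ℝ} {g h : L1 n} (hg : HeatSmall t ε g) (hh : |h| ≤ g) :
    HeatSmall t ε h :=
  ⟨(norm_le_norm_of_abs_le_abs (hh.trans (le_abs_self _))).trans hg.1,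
    ae_abs_le_of_abs_le hh hg.2⟩

lemma HeatSmall.mono {t ε δ : ℝ} {g : L1 n} (hg : HeatSmall t ε g) (ht : 0 ≤ t) (h : ε ≤ δ) :
    HeatSmall t δ g := by
  refine ⟨hg.1.trans h, ?_⟩
  filter_upwards [hg.2] with x hx
  exact hx.trans (mul_le_mul_of_nonneg_right h (Real.rpow_nonneg ht _))

lemma rpow_neg_half_le {t c : ℝ} (ht : 0 < t) (h : t ≤ c) :
    c ^ (-(n : ℝ) / 2) ≤ t ^ (-(n : ℝ) / 2) :=
  Real.rpow_le_rpow_of_nonpos ht h (by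
    have : (0 : ℝ) ≤ n := n.cast_nonneg
    linarith)

/-- Half of the time already gives the rate t^{-n/2} with constant one, because 4π(t/2) ≥ t. The
other half stays available for making the L¹ norm small. -/
lemma heatSmall_heatL1_half {t : ℝ} (ht : 0 < t) (g : L1 n) :
    HeatSmall t ‖g‖ (heatL1 (t / 2) g) := by
  refine ⟨norm_heatL1_le _ _, ?_⟩
  filter_upwards [ae_abs_heatL1_le (half_pos ht) g] with x hx
  refine hx.trans ?_
  rw [mul_comm]
  refine mul_le_mul_of_nonneg_left (rpow_neg_half_le ht ?_) (norm_nonneg g)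
  nlinarith [Real.pi_gt_three]

lemma heatSmall_heatL1 {t : ℝ} (ht : 0 < t) (g : L1 n) : HeatSmall t ‖g‖ (heatL1 t g) := by
  have h := heatSmall_heatL1_half ht (heatL1 (t / 2) g)
  rw [heatL1_heatL1 (by positivity) (by positivity), add_halves] at h
  exact h.mono ht.le (norm_heatL1_le _ _)

/-- The Gauss kernel as an element of `L¹`. -/
noncomputable def gaussL1 (t : ℝ) : L1 n := toL1 (gaussKernel t)

lemma coeFn_gaussL1 {t : ℝ} (ht : 0 < t) : (gaussL1 t : L1 n) =ᵐ[volume] gaussKernel t :=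
  coeFn_toL1 (integrable_gaussKernel ht)

lemma heatL1_gaussL1 {t s : ℝ} (ht : 0 ≤ t) (hs : 0 < s) :
    heatL1 t (gaussL1 s : L1 n) = gaussL1 (t + s) := by
  rcases ht.eq_or_lt with rfl | ht
  · rw [heatL1_of_nonpos le_rfl, zero_add]
  rw [gaussL1, ← toL1_heat (integrable_gaussKernel hs), gaussL1]
  congr 1
  ext x
  rw [heat_of_pos ht, integral_gaussKernel_mul ht hs]

lemma integral_gaussL1 {t : ℝ} (ht : 0 < t) : ∫ x, (gaussL1 t : L1 n) x = 1 := by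
  rw [integral_congr_ae (coeFn_gaussL1 ht), integral_gaussKernel ht]

lemma norm_gaussL1 {t : ℝ} (ht : 0 < t) : ‖(gaussL1 t : L1 n)‖ = 1 := by
  rw [norm_eq_integral_abs, ← integral_gaussKernel (n := n) ht]
  refine integral_congr_ae ?_
  filter_upwards [coeFn_gaussL1 ht] with x hx
  rw [hx, abs_of_nonneg (gaussKernel_nonneg t ht.le x)]

lemma heatSmall_gaussL1 {t : ℝ} (ht : 0 < t) : HeatSmall t 1 (gaussL1 t : L1 n) := by
  have h := heatSmall_heatL1_half ht (gaussL1 (t / 2) : L1 n)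
  rwa [heatL1_gaussL1 (by positivity) (half_pos ht), add_halves, norm_gaussL1 (half_pos ht)] at h

/-- Split t - T as t/2 + (t/2 - T): the second piece makes the L¹ norm small, the first converts
this into L^∞ decay. -/
lemma eventually_heatSmall_of_integral_eq_zero {g : L1 n} (hg : ∫ x, g x = 0) (T : ℝ) {ε : ℝ}
    (hε : 0 < ε) : ∀ᶠ t in atTop, HeatSmall t ε (heatL1 (t - T) g) := by
  have h1 : Tendsto (fun t : ℝ => t / 2 - T) atTop atTop :=
    tendsto_atTop_add_const_right _ (-T) (tendsto_id.atTop_div_const two_pos)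
  have h2 := ((tendsto_norm_heatL1_of_integral_eq_zero hg).comp h1).eventually_lt_const hε
  filter_upwards [h2, h1.eventually_ge_atTop 0, eventually_gt_atTop 0] with t h3 h4 h5
  have h := heatSmall_heatL1_half h5 (heatL1 (t / 2 - T) g)
  rw [heatL1_heatL1 (by positivity) h4, ← add_sub_assoc, add_halves] at h
  exact h.mono h5.le h3.le

/-- The integral as a continuous linear functional on `L¹`. -/
noncomputable def massCLM : L1 n →L[ℝ] ℝ := L1.integralCLM

lemma massCLM_apply (g : L1 n) : massCLM g = ∫ x, g x := by
  rw [massCLM, ← L1.integral_eq, L1.integral_eq_integral]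

section Asymptotics

variable {p K : ℝ} {f : ℝ → ℝ} {φ : L1 n} {a : ℝ → ℝ} {u : ℝ → L1 n}

lemma SmallData.integrableOn_weight (hd : SmallData p K f φ a) :
    IntegrableOn (fun s => K * a s ^ (p - 1)) (Ioi 0) := by
  refine integrableOn_Ioi_of_intervalIntegral_norm_bounded (1 / 4) 0
    (fun i => (hd.continuous_weight.integrableOn_Ioc)) tendsto_id ?_
  filter_upwards [eventually_ge_atTop 0] with t ht
  simp_rw [Real.norm_of_nonneg (hd.weight_nonneg _)]
  exact hd.integral_le t ht

lemma SmallData.integrableOn_superposition (hd : SmallData p K f φ a) (hu : Dominated φ u) :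
    IntegrableOn (fun s => superposition f (u s)) (Ioi 0) := by
  refine ((hd.integrableOn_weight.const_mul 2).mul_const ‖φ‖).mono'
    (hd.continuous_superposition hu).aestronglyMeasurable ?_
  filter_upwards with s
  have h : ‖superposition f (u s)‖ ≤ ‖(2 * (K * a s ^ (p - 1))) • heatL1 s (|φ|)‖ :=
    norm_le_norm_of_abs_le_abs ((hd.abs_superposition_le hu s).trans (le_abs_self _))
  have h2 := norm_heatL1_le s (|φ|)
  rw [norm_abs_eq_norm] at h2
  have h3 := hd.weight_nonneg s
  rw [norm_smul, Real.norm_of_nonneg (by positivity)] at h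
  exact h.trans (mul_le_mul_of_nonneg_left h2 (by positivity))

/-- The heat flow preserves mass, so the mass of u(t) is that of φ plus the accumulated mass of
f(u(s)). -/
lemma SmallData.tendsto_mass (hd : SmallData p K f φ a) (hu : Dominated φ u)
    (hfix : duhamel f φ u = u) :
    Tendsto (fun t => massCLM (u t)) atTop
      (𝓝 (massCLM (φ + ∫ s in Ioi (0 : ℝ), superposition f (u s)))) := by
  have h1 := intervalIntegral_tendsto_integral_Ioi 0 (hd.integrableOn_superposition hu)
    tendsto_id
  have h2 := ((massCLM (n := n)).continuous.tendsto _).comp (h1.const_add φ)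
  refine h2.congr' ?_
  filter_upwards [eventually_ge_atTop 0] with t ht
  have hi := (hd.continuous_superposition hu).intervalIntegrable (μ := volume) 0 t
  rw [Function.comp_apply, id, eq_of_duhamel_eq hfix ht, map_add, map_add,
    ← ContinuousLinearMap.intervalIntegral_comp_comm _ hi,
    ← ContinuousLinearMap.intervalIntegral_comp_comm _ (hd.intervalIntegrable_integrand hu t 0 t)]
  simp_rw [massCLM_apply, integral_heatL1]

lemma SmallData.tendsto_tail (hd : SmallData p K f φ a) :
    Tendsto (fun T => ∫ s in Ioi T, K * a s ^ (p - 1)) atTop (𝓝 0) := by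
  have h1 := intervalIntegral_tendsto_integral_Ioi 0 hd.integrableOn_weight tendsto_id
  have h2 := h1.const_sub (∫ s in Ioi (0 : ℝ), K * a s ^ (p - 1))
  rw [sub_self] at h2
  refine h2.congr' ?_
  filter_upwards [eventually_ge_atTop 0] with T hT
  rw [sub_eq_iff_eq_add', id, intervalIntegral.integral_of_le hT, ← setIntegral_union
    Ioc_disjoint_Ioi_same measurableSet_Ioi
    (hd.integrableOn_weight.mono_set Ioc_subset_Ioi_self)
    (hd.integrableOn_weight.mono_set (Ioi_subset_Ioi hT)), Ioc_union_Ioi_eq_Ioi hT]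

/-- The solution is asymptotic to the multiple of the Gauss kernel with the limiting mass. -/
theorem SmallData.eventually_heatSmall (hd : SmallData p K f φ a) (hu : Dominated φ u)
    (hfix : duhamel f φ u = u) {ε : ℝ} (hε : 0 < ε) :
    ∀ᶠ t in atTop, HeatSmall t ε
      (u t - massCLM (φ + ∫ s in Ioi (0 : ℝ), superposition f (u s)) • gaussL1 t) := by
  set M := massCLM (φ + ∫ s in Ioi (0 : ℝ), superposition f (u s))
  have hM : ∀ᶠ T in atTop, |massCLM (u T) - M| ≤ ε / 3 := by
    have h := ((hd.tendsto_mass hu hfix).sub_const M).abs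
    rw [sub_self, abs_zero] at h
    exact (h.eventually_lt_const (by positivity : 0 < ε / 3)).mono fun _ h => h.le
  have htail : ∀ᶠ T in atTop, (2 * ∫ s in Ioi T, K * a s ^ (p - 1)) * ‖φ‖ ≤ ε / 3 := by
    have h := (hd.tendsto_tail.const_mul 2).mul_const ‖φ‖
    rw [mul_zero, zero_mul] at h
    exact (h.eventually_lt_const (by positivity : 0 < ε / 3)).mono fun _ h => h.le
  -- A single T makes both the remaining mass variation and the Duhamel tail cost at most ε/3; the
  -- third ε/3 goes to the mean-zero part.
  obtain ⟨T, h1, h2, hT⟩ := (hM.and (htail.and (eventually_gt_atTop 0))).exists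
  -- Subtracting G_T, at the same time T, makes its image under e^{(t-T)Δ} exactly G_t.
  set ψ : L1 n := u T - massCLM (u T) • gaussL1 T with hψ
  have hψ0 : ∫ x, ψ x = 0 := by
    rw [← massCLM_apply, hψ, map_sub, map_smul, massCLM_apply (gaussL1 T), integral_gaussL1 hT]
    simp
  filter_upwards [eventually_heatSmall_of_integral_eq_zero hψ0 T (by positivity : 0 < ε / 3),
    eventually_gt_atTop T] with t h3 ht
  have ht0 : 0 < t := hT.trans ht
  have key : u t - M • gaussL1 t = (u t - heatL1 (t - T) (u T)) + heatL1 (t - T) ψ +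
      (massCLM (u T) - M) • gaussL1 t := by
    rw [hψ, map_sub, map_smul, heatL1_gaussL1 (sub_nonneg.2 ht.le) hT, sub_add_cancel, sub_smul]
    abel
  have e1 : HeatSmall t (ε / 3) (u t - heatL1 (t - T) (u T)) := by
    have h4 := (heatSmall_heatL1 ht0 (|φ|)).smul (2 * ∫ s in T..t, K * a s ^ (p - 1))
    have h5 : 0 ≤ ∫ s in T..t, K * a s ^ (p - 1) :=
      intervalIntegral.integral_nonneg ht.le fun s _ => hd.weight_nonneg s
    refine (h4.of_abs_le (hd.abs_sub_restart_le hu hfix hT.le ht.le)).mono ht0.le (le_trans ?_ h2)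
    rw [abs_of_nonneg (by positivity), norm_abs_eq_norm]
    gcongr
    rw [intervalIntegral.integral_of_le ht.le]
    exact setIntegral_mono_set (hd.integrableOn_weight.mono_set (Ioi_subset_Ioi hT.le))
      (Eventually.of_forall fun s => hd.weight_nonneg s) Ioc_subset_Ioi_self.eventuallyLE
  have e3 : HeatSmall t (ε / 3) ((massCLM (u T) - M) • (gaussL1 t : L1 n)) :=
    ((heatSmall_gaussL1 ht0).smul _).mono ht0.le (by rwa [mul_one])
  rw [key, show ε = ε / 3 + ε / 3 + ε / 3 by ring]
  exact (e1.add h3).add e3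

end Asymptotics

/-! ### Polynomial weights -/

lemma one_add_pow_mul_exp_le (m : ℕ) : ∃ C : ℝ, 0 ≤ C ∧ ∀ r : ℝ, 0 ≤ r →
    (1 + r) ^ m * Real.exp (-(1 / 4) * r ^ 2) ≤ C * Real.exp (-(1 / 8) * r ^ 2) := by
  refine ⟨m.factorial * Real.exp 3, by positivity, fun r hr => ?_⟩
  have h1 := Real.pow_div_factorial_le_exp (x := 1 + r) (by positivity) m
  rw [div_le_iff₀ (by positivity)] at h1
  have h2 : Real.exp (1 + r) ≤ Real.exp (3 + 1 / 8 * r ^ 2) :=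
    -- Equivalent to (r - 4)² ≥ 0, whence the constant 3.
    Real.exp_le_exp.2 (by nlinarith [sq_nonneg (r - 4)])
  calc (1 + r) ^ m * Real.exp (-(1 / 4) * r ^ 2)
      ≤ (Real.exp (3 + 1 / 8 * r ^ 2) * m.factorial) * Real.exp (-(1 / 4) * r ^ 2) := by
        gcongr
        exact h1.trans (by gcongr)
    _ = m.factorial * Real.exp 3 * Real.exp (-(1 / 8) * r ^ 2) := by
        rw [mul_comm (Real.exp _), mul_assoc, ← Real.exp_add, mul_assoc, ← Real.exp_add]
        congr 2; ring

lemma integrable_exp_neg_mul_sq_norm {b : ℝ} (hb : 0 < b) :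
    Integrable fun x : Space n => Real.exp (-b * ‖x‖ ^ 2) := by
  -- The Bochner integral of a non-integrable function is 0 by convention, so a nonzero value proves
  -- integrability.
  refine not_imp_comm.1 integral_undef ?_
  rw [GaussianFourier.integral_rexp_neg_mul_sq_norm hb]
  positivity

lemma gaussKernel_one_eq (x : Space n) :
    gaussKernel 1 x = (4 * Real.pi) ^ (-(n : ℝ) / 2) * Real.exp (-(1 / 4) * ‖x‖ ^ 2) := by
  rw [gaussKernel_eq_exp]; simp

lemma integrable_weight_mul_gaussKernel_one (m : ℕ) :
    Integrable fun x : Space n => (1 + ‖x‖) ^ m * gaussKernel 1 x := by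
  obtain ⟨C, -, hC⟩ := one_add_pow_mul_exp_le m
  refine ((integrable_exp_neg_mul_sq_norm (by norm_num : (0 : ℝ) < 1 / 8)).const_mul
    ((4 * Real.pi) ^ (-(n : ℝ) / 2) * C)).mono' ?_ ?_
  · exact (Continuous.mul (by fun_prop) (continuous_gaussKernel 1)).aestronglyMeasurable
  · filter_upwards with x
    rw [Real.norm_of_nonneg (mul_nonneg (by positivity) (gaussKernel_nonneg 1 zero_le_one x)),
      gaussKernel_one_eq, mul_left_comm, mul_assoc]
    exact mul_le_mul_of_nonneg_left (hC _ (norm_nonneg x)) (by positivity)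

/-- Substitute x = √s z and use 1 + √s|z| ≤ √(1+s)(1+|z|). -/
lemma integral_weight_mul_gaussKernel_le (m : ℕ) {s : ℝ} (hs : 0 < s) :
    Integrable (fun x : Space n => (1 + ‖x‖) ^ m * gaussKernel s x) ∧
    ∫ x : Space n, (1 + ‖x‖) ^ m * gaussKernel s x ≤
      (1 + s) ^ ((m : ℝ) / 2) * ∫ x : Space n, (1 + ‖x‖) ^ m * gaussKernel 1 x := by
  have hle : ∀ z : Space n, (1 + ‖√s • z‖) ^ m ≤ (1 + s) ^ ((m : ℝ) / 2) * (1 + ‖z‖) ^ m := by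
    intro z
    have h1 : (1 + s) ^ ((m : ℝ) / 2) = √(1 + s) ^ m := by
      rw [Real.sqrt_eq_rpow, ← Real.rpow_natCast, ← Real.rpow_mul (by positivity)]
      congr 1; ring
    rw [h1, ← mul_pow]
    have h2 : 1 ≤ √(1 + s) := Real.one_le_sqrt.2 (by linarith)
    have h3 : √s ≤ √(1 + s) := Real.sqrt_le_sqrt (by linarith)
    rw [norm_smul, Real.norm_of_nonneg (Real.sqrt_nonneg s)]
    gcongr
    nlinarith [norm_nonneg z]
  have h1 := integrable_weight_mul_gaussKernel_one (n := n) m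
  have hmeas : AEStronglyMeasurable fun z : Space n => (1 + ‖√s • z‖) ^ m * gaussKernel 1 z :=
    (Continuous.mul (by fun_prop) (continuous_gaussKernel 1)).aestronglyMeasurable
  have h2 : Integrable fun z : Space n => (1 + ‖√s • z‖) ^ m * gaussKernel 1 z := by
    refine (h1.const_mul ((1 + s) ^ ((m : ℝ) / 2))).mono' hmeas ?_
    filter_upwards with z
    rw [Real.norm_of_nonneg (mul_nonneg (by positivity) (gaussKernel_nonneg 1 zero_le_one z)),
      ← mul_assoc]
    exact mul_le_mul_of_nonneg_right (hle z) (gaussKernel_nonneg 1 zero_le_one z)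
  constructor
  · rw [← integrable_comp_smul_iff volume _ (Real.sqrt_pos.2 hs).ne']
    refine (h2.const_mul (s ^ (-(n : ℝ) / 2))).congr ?_
    filter_upwards with z
    rw [gaussKernel_sqrt_smul hs]; ring
  · rw [← integral_const_mul]
    simp_rw [mul_comm _ (gaussKernel s _)]
    rw [integral_gaussKernel_mul_eq hs fun x => (1 + ‖x‖) ^ m]
    refine integral_mono (h2.congr (by filter_upwards with z; ring)) (h1.const_mul _) fun z => ?_
    simp only
    rw [mul_comm, ← mul_assoc]
    exact mul_le_mul_of_nonneg_right (hle z) (gaussKernel_nonneg 1 zero_le_one z)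

/-- Makes a weighted convolution at most the convolution of the weighted factors. -/
lemma weight_submultiplicative (m : ℕ) (x y : Space n) :
    (1 + ‖x‖) ^ m ≤ (1 + ‖x - y‖) ^ m * (1 + ‖y‖) ^ m := by
  rw [← mul_pow]
  gcongr
  have := norm_sub_norm_le x y
  nlinarith [norm_nonneg (x - y), norm_nonneg y, mul_nonneg (norm_nonneg (x - y)) (norm_nonneg y)]

/-- Growth of the moments of the heat flow. -/
lemma integral_weight_mul_heatL1_le (m : ℕ) {g : L1 n} (h0 : 0 ≤ g)
    (hg : Integrable fun x => (1 + ‖x‖) ^ m * g x) {s : ℝ} (hs : 0 < s) :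
    Integrable (fun x => (1 + ‖x‖) ^ m * heatL1 s g x) ∧
    ∫ x, (1 + ‖x‖) ^ m * heatL1 s g x ≤
      (∫ x : Space n, (1 + ‖x‖) ^ m * gaussKernel 1 x) * (∫ x, (1 + ‖x‖) ^ m * g x) *
        (1 + s) ^ ((m : ℝ) / 2) := by
  obtain ⟨hG, hGle⟩ := integral_weight_mul_gaussKernel_le (n := n) m hs
  have hconv := hG.integrable_convolution (ContinuousLinearMap.mul ℝ ℝ) hg
  have hint := integral_convolution (ContinuousLinearMap.mul ℝ ℝ) hG hg
  have h0' := (Lp.coeFn_nonneg g).2 h0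
  have hgw : 0 ≤ ∫ x, (1 + ‖x‖) ^ m * g x := by
    refine integral_nonneg_of_ae ?_
    filter_upwards [h0'] with x hx
    exact mul_nonneg (by positivity) hx
  have hle : ∀ᵐ x, (1 + ‖x‖) ^ m * heatL1 s g x ≤
      convolution (fun x => (1 + ‖x‖) ^ m * gaussKernel s x) (fun x => (1 + ‖x‖) ^ m * g x)
        (ContinuousLinearMap.mul ℝ ℝ) volume x := by
    filter_upwards [coeFn_heatL1 s g, hG.ae_convolution_exists (ContinuousLinearMap.mul ℝ ℝ) hg]
      with x h1 h2
    have h2' := h2.integrable_swap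
    rw [h1, heat_of_pos hs, convolution_mul_swap, ← integral_const_mul]
    refine integral_mono_ae ((integrable_gaussKernel_mul (integrable_L1 g) hs x).const_mul _)
      h2' ?_
    filter_upwards [h0'] with y hy
    have := weight_submultiplicative m x y
    have hGn := gaussKernel_nonneg s hs.le (x - y)
    have hgy : 0 ≤ g y := hy
    calc (1 + ‖x‖) ^ m * (gaussKernel s (x - y) * g y)
        ≤ ((1 + ‖x - y‖) ^ m * (1 + ‖y‖) ^ m) * (gaussKernel s (x - y) * g y) := by gcongr
      _ = (1 + ‖x - y‖) ^ m * gaussKernel s (x - y) * ((1 + ‖y‖) ^ m * g y) := by ring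
  have hnn := (Lp.coeFn_nonneg _).2 (heatL1_nonneg s h0)
  have hi : Integrable fun x => (1 + ‖x‖) ^ m * heatL1 s g x := by
    refine hconv.mono' (AEStronglyMeasurable.mul (Continuous.aestronglyMeasurable (by fun_prop))
      (integrable_L1 _).aestronglyMeasurable) ?_
    filter_upwards [hle, hnn] with x h1 h2
    rwa [Real.norm_of_nonneg (mul_nonneg (by positivity) h2)]
  refine ⟨hi, (integral_mono_ae hi hconv hle).trans ?_⟩
  rw [hint, ContinuousLinearMap.mul_apply']
  exact (mul_le_mul_of_nonneg_right hGle hgw).trans_eq (by ring)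

/-! ### Weighted integrability of `φ₁` -/

lemma integrable_min_weight_mul (m : ℕ) (R : ℝ≥0) (g : L1 n) :
    Integrable fun x => min ((1 + ‖x‖) ^ m) (R : ℝ) * g x := by
  refine (integrable_L1 g).bdd_mul (c := R)
    (Continuous.aestronglyMeasurable (by fun_prop)) ?_
  filter_upwards with x
  rw [Real.norm_of_nonneg (by positivity)]
  exact min_le_right _ _

/-- Integration against the truncated weight `min((1 + |x|)^m, R)`. -/
noncomputable def truncatedMoment (m : ℕ) (R : ℝ≥0) : L1 n →L[ℝ] ℝ :=
  have hint := integrable_min_weight_mul (n := n) m R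
  LinearMap.mkContinuous
    { toFun := fun g => ∫ x, min ((1 + ‖x‖) ^ m) (R : ℝ) * g x
      map_add' := fun g h => by
        rw [← integral_add (hint g) (hint h)]
        refine integral_congr_ae ?_
        filter_upwards [Lp.coeFn_add g h] with x hx
        rw [hx, Pi.add_apply, mul_add]
      map_smul' := fun c g => by
        rw [smul_eq_mul, ← integral_const_mul]
        refine integral_congr_ae ?_
        filter_upwards [Lp.coeFn_smul c g] with x hx
        rw [hx, Pi.smul_apply, smul_eq_mul, RingHom.id_apply]
        ring }
    R fun g => by
      rw [norm_eq_integral_abs, ← integral_const_mul]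
      refine abs_integral_le_integral_abs.trans
        (integral_mono (hint g).abs ((integrable_L1 g).abs.const_mul _) fun x => ?_)
      simp only
      rw [abs_mul, abs_of_nonneg (by positivity)]
      exact mul_le_mul_of_nonneg_right (min_le_right _ _) (abs_nonneg _)

lemma truncatedMoment_apply (m : ℕ) (R : ℝ≥0) (g : L1 n) :
    truncatedMoment m R g = ∫ x, min ((1 + ‖x‖) ^ m) (R : ℝ) * g x := rfl

/-- The full moment is not continuous on L¹, while truncated moments are and commute with Bochner
integrals. A bound uniform in R passes to the full weight by Fatou. -/
lemma integrable_weight_mul_of_truncatedMoment_le (m : ℕ) {g : L1 n} (h0 : 0 ≤ g) {B : ℝ}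
    (hB : ∀ R : ℕ, truncatedMoment m R g ≤ B) : Integrable fun x => (1 + ‖x‖) ^ m * g x := by
  have h0' := (Lp.coeFn_nonneg g).2 h0
  have hlim : ∀ᵐ x, Tendsto (fun R : ℕ => min ((1 + ‖x‖) ^ m) (((R : ℝ≥0) : ℝ)) * g x) atTop
      (𝓝 ((1 + ‖x‖) ^ m * g x)) := by
    filter_upwards with x
    refine Tendsto.congr' ?_ tendsto_const_nhds
    filter_upwards [eventually_ge_atTop ⌈(1 + ‖x‖) ^ m⌉₊] with R hR
    rw [min_eq_left]
    simpa using Nat.ceil_le.1 hR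
  have hmeas := fun R : ℕ => (integrable_min_weight_mul m R g).aestronglyMeasurable
  refine ⟨aestronglyMeasurable_of_tendsto_ae _ hmeas hlim,
    lt_of_le_of_lt ((lintegral_congr_ae ?_).trans_le
      (lintegral_liminf_le' (u := atTop) fun R => (hmeas R).aemeasurable.enorm)) ?_⟩
  · filter_upwards [hlim] with x hx using hx.enorm.liminf_eq.symm
  refine lt_of_le_of_lt ((liminf_le_liminf (v := fun _ => ENNReal.ofReal B)
    (Eventually.of_forall fun R => ?_)).trans_eq (liminf_const _)) ENNReal.ofReal_lt_top
  refine le_trans (le_of_eq ?_) (ENNReal.ofReal_le_ofReal (hB R))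
  rw [truncatedMoment_apply, ofReal_integral_eq_lintegral_ofReal (integrable_min_weight_mul m R g)]
  · refine lintegral_congr_ae ?_
    filter_upwards [h0'] with x hx
    have hx' : 0 ≤ g x := hx
    rw [Real.enorm_of_nonneg (by positivity)]
  · filter_upwards [h0'] with x hx
    have hx' : 0 ≤ g x := hx
    show 0 ≤ _
    positivity

section Moments

variable {p K : ℝ} {f : ℝ → ℝ} {φ : L1 n} {a : ℝ → ℝ} {u : ℝ → L1 n}

/-- The Bochner integral of f(u(s)) is dominated by Q, the integral of 2K a(s)^{p-1} e^{sΔ}|φ|.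
Nonnegativity of Q allows the Fatou argument, and `ha` absorbs the growth (1+s)^{m/2} of the
moments. -/
theorem SmallData.integrable_weight_mul (hd : SmallData p K f φ a) (hu : Dominated φ u) (m : ℕ)
    (hφ : Integrable fun x => (1 + ‖x‖) ^ m * φ x)
    (ha : IntegrableOn (fun s => (K * a s ^ (p - 1)) * (1 + s) ^ ((m : ℝ) / 2)) (Ioi 0)) :
    Integrable fun x => (1 + ‖x‖) ^ m *
      (φ + ∫ s in Ioi (0 : ℝ), superposition f (u s)) x := by
  have h0 : 0 ≤ |φ| := abs_nonneg φ
  have hφ' : Integrable fun x => (1 + ‖x‖) ^ m * (|φ| : L1 n) x := by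
    refine hφ.abs.congr ?_
    filter_upwards [Lp.coeFn_abs φ] with x hx
    rw [hx, abs_mul, abs_of_nonneg (by positivity)]
  set P : ℝ → L1 n := fun s => (2 * (K * a s ^ (p - 1))) • heatL1 s (|φ|) with hP
  have hP0 : ∀ s, 0 ≤ P s := fun s =>
    smul_nonneg (mul_nonneg zero_le_two (hd.weight_nonneg s)) (heatL1_nonneg s h0)
  have hPc : Continuous P :=
    (continuous_const.mul hd.continuous_weight).smul (continuous_heatL1_apply _)
  have hPi : IntegrableOn P (Ioi 0) := by
    refine ((hd.integrableOn_weight.const_mul 2).mul_const ‖φ‖).mono' hPc.aestronglyMeasurable ?_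
    filter_upwards with s
    have h2 := norm_heatL1_le s (|φ|)
    rw [norm_abs_eq_norm] at h2
    have h3 := hd.weight_nonneg s
    rw [hP, norm_smul, Real.norm_of_nonneg (by positivity)]
    exact mul_le_mul_of_nonneg_left h2 (by positivity)
  set Q : L1 n := ∫ s in Ioi (0 : ℝ), P s with hQ
  have hQ0 : 0 ≤ Q := integral_nonneg hP0
  set A := (∫ x : Space n, (1 + ‖x‖) ^ m * gaussKernel 1 x) *
    (∫ x, (1 + ‖x‖) ^ m * (|φ| : L1 n) x) with hA
  have hQw : Integrable fun x => (1 + ‖x‖) ^ m * Q x := by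
    refine integrable_weight_mul_of_truncatedMoment_le m hQ0
      (B := ∫ s in Ioi (0 : ℝ), 2 * A * ((K * a s ^ (p - 1)) * (1 + s) ^ ((m : ℝ) / 2)))
      fun R => ?_
    rw [hQ, ← ContinuousLinearMap.integral_comp_comm _ hPi]
    refine setIntegral_mono_on ((truncatedMoment m R).integrable_comp hPi) (ha.const_mul _)
      measurableSet_Ioi fun s hs => ?_
    obtain ⟨hi, hle⟩ := integral_weight_mul_heatL1_le m h0 hφ' hs
    have h3 := hd.weight_nonneg s
    have htr : truncatedMoment m R (heatL1 s (|φ|)) ≤ A * (1 + s) ^ ((m : ℝ) / 2) := by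
      refine le_trans ?_ hle
      rw [truncatedMoment_apply]
      refine integral_mono_ae (integrable_min_weight_mul m R _) hi ?_
      filter_upwards [(Lp.coeFn_nonneg _).2 (heatL1_nonneg s h0)] with x hx
      exact mul_le_mul_of_nonneg_right (min_le_left _ _) hx
    rw [hP, map_smul, smul_eq_mul]
    calc _ ≤ 2 * (K * a s ^ (p - 1)) * (A * (1 + s) ^ ((m : ℝ) / 2)) := by gcongr
      _ = _ := by ring
  have hle : |∫ s in Ioi (0 : ℝ), superposition f (u s)| ≤ Q := by
    have hi := hd.integrableOn_superposition hu
    refine abs_le'.2 ⟨integral_mono hi hPi fun s =>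
      (le_abs_self _).trans (hd.abs_superposition_le hu s), ?_⟩
    rw [← integral_neg]
    exact integral_mono hi.neg hPi fun s => (neg_le_abs _).trans (hd.abs_superposition_le hu s)
  refine (hφ.abs.add hQw).mono' (AEStronglyMeasurable.mul
    (Continuous.aestronglyMeasurable (by fun_prop)) (integrable_L1 _).aestronglyMeasurable) ?_
  filter_upwards [L1_abs_le_iff.1 hle,
    Lp.coeFn_add φ (∫ s in Ioi (0 : ℝ), superposition f (u s))] with x h1 h2
  have hw : (0 : ℝ) ≤ (1 + ‖x‖) ^ m := by positivity
  rw [h2, Pi.add_apply, Pi.add_apply, norm_mul, Real.norm_of_nonneg hw, Real.norm_eq_abs,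
    abs_mul, abs_of_nonneg hw, ← mul_add]
  exact mul_le_mul_of_nonneg_left ((abs_add_le _ _).trans (by gcongr)) hw

end Moments

lemma abs_monomial_le (α : Fin n → ℕ) {m : ℕ} (hα : ∑ j, α j ≤ m) (x : Space n) :
    |monomial α x| ≤ (1 + ‖x‖) ^ m := by
  rw [monomial, Finset.abs_prod]
  calc ∏ j, |x j ^ α j| ≤ ∏ j, (1 + ‖x‖) ^ α j := by
        refine Finset.prod_le_prod (fun j _ => abs_nonneg _) fun j _ => ?_
        rw [abs_pow]
        gcongr
        have h := PiLp.norm_apply_le x j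
        rw [Real.norm_eq_abs] at h
        linarith
    _ = (1 + ‖x‖) ^ ∑ j, α j := Finset.prod_pow_eq_pow_sum _ _ _
    _ ≤ (1 + ‖x‖) ^ m := pow_le_pow_right₀ (by linarith [norm_nonneg x]) hα

lemma continuous_monomial (α : Fin n → ℕ) : Continuous (monomial α : Space n → ℝ) := by
  unfold monomial; fun_prop

lemma memL1Weighted_of_integrable_weight {m : ℕ} {g : Space n → ℝ}
    (hm : AEStronglyMeasurable g) (h : Integrable fun x => (1 + ‖x‖) ^ m * g x) :
    MemL1Weighted m g := by
  intro α hα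
  refine h.mono ((continuous_monomial α).aestronglyMeasurable.mul hm) ?_
  filter_upwards with x
  rw [norm_mul, norm_mul, Real.norm_of_nonneg (show (0 : ℝ) ≤ (1 + ‖x‖) ^ m by positivity)]
  exact mul_le_mul_of_nonneg_right (abs_monomial_le α hα x) (norm_nonneg _)

/-- The largest coordinate decides: if it is at most 1 the constant term suffices, otherwise its
m-th power does. Thus only pure powers of coordinates are needed to control the radial weight. -/
lemma one_add_norm_pow_le (m : ℕ) (x : Space n) :
    (1 + ‖x‖) ^ m ≤ (1 + n) ^ m * (1 + ∑ j, |x j| ^ m) := by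
  have hsum : ‖x‖ ≤ ∑ j, |x j| := by
    rw [EuclideanSpace.norm_eq, Real.sqrt_le_left (by positivity)]
    simp only [Real.norm_eq_abs]
    exact Finset.sum_sq_le_sq_sum_of_nonneg fun j _ => abs_nonneg _
  have h1 : (1 : ℝ) ≤ 1 + ∑ j, |x j| ^ m := le_add_of_nonneg_right (by positivity)
  rcases isEmpty_or_nonempty (Fin n) with h | h
  · have h0 : ‖x‖ = 0 := le_antisymm (by simpa using hsum) (norm_nonneg x)
    rw [h0, add_zero, one_pow]
    exact one_le_mul_of_one_le_of_one_le (one_le_pow₀ (by simp)) h1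
  · obtain ⟨i, hi⟩ := Finite.exists_max fun j => |x j|
    have h2 : ‖x‖ ≤ n * |x i| := hsum.trans (by
      simpa using Finset.sum_le_card_nsmul Finset.univ (fun j => |x j|) _ fun j _ => hi j)
    rcases le_total |x i| 1 with h3 | h3
    · calc (1 + ‖x‖) ^ m ≤ (1 + n) ^ m := by
            gcongr
            exact h2.trans (mul_le_of_le_one_right (by positivity) h3)
        _ ≤ _ := le_mul_of_one_le_right (by positivity) h1
    · calc (1 + ‖x‖) ^ m ≤ ((1 + n) * |x i|) ^ m := by
            gcongr
            linarith
        _ = (1 + n) ^ m * |x i| ^ m := mul_pow _ _ _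
        _ ≤ _ := by
            gcongr
            have := Finset.single_le_sum (f := fun j => |x j| ^ m)
              (fun j _ => by positivity) (Finset.mem_univ i)
            simp only at this
            linarith

/-- It is enough to test the multi-indices 0 and m e_j. -/
lemma integrable_weight_mul_of_memL1Weighted {m : ℕ} {g : Space n → ℝ}
    (h : MemL1Weighted m g) : Integrable fun x => (1 + ‖x‖) ^ m * g x := by
  have hg : Integrable g := by simpa [monomial] using h 0 (by simp)
  have hj : ∀ j : Fin n, Integrable fun x : Space n => x j ^ m * g x := fun j => by
    have := h (Pi.single j m) (by simp)
    refine this.congr ?_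
    filter_upwards with x
    rw [monomial, Finset.prod_eq_single j (fun i _ hij => by simp [hij]) (by simp)]
    simp
  have hs : Integrable fun x : Space n => (1 + n : ℝ) ^ m * (|g x| + ∑ j, |x j ^ m * g x|) :=
    (hg.abs.add (integrable_finsetSum _ fun j _ => (hj j).abs)).const_mul _
  refine hs.mono' (AEStronglyMeasurable.mul (Continuous.aestronglyMeasurable (by fun_prop))
    hg.aestronglyMeasurable) ?_
  filter_upwards with x
  rw [norm_mul, Real.norm_of_nonneg (by positivity), Real.norm_eq_abs]
  refine (mul_le_mul_of_nonneg_right (one_add_norm_pow_le m x) (abs_nonneg _)).trans_eq ?_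
  simp_rw [abs_mul, abs_pow, ← Finset.sum_mul]
  ring

/-! ### Hermite functions -/

/-- All that is needed of the Hermite functions is polynomial growth times a Gaussian, hence
boundedness and integrability of h_α G₁. -/
lemma exists_polynomial_iteratedDeriv_gaussian (k : ℕ) : ∃ P : Polynomial ℝ,
    iteratedDeriv k (fun y : ℝ => Real.exp (-y ^ 2)) = fun y => P.eval y * Real.exp (-y ^ 2) := by
  induction k with
  | zero => exact ⟨1, by simp⟩
  | succ k ih =>
    obtain ⟨P, hP⟩ := ih
    refine ⟨P.derivative - 2 * Polynomial.X * P, ?_⟩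
    rw [iteratedDeriv_succ, hP]
    ext y
    have h1 : HasDerivAt (fun y : ℝ => Real.exp (-y ^ 2)) (Real.exp (-y ^ 2) * (-(2 * y))) y := by
      have := ((hasDerivAt_pow 2 y).neg).exp
      simpa using this
    refine ((P.hasDerivAt y).mul h1).deriv.trans ?_
    simp
    ring

lemma exists_polynomial_hermite (k : ℕ) : ∃ P : Polynomial ℝ, ∀ x, hermite k x = P.eval x := by
  obtain ⟨P, hP⟩ := exists_polynomial_iteratedDeriv_gaussian k
  refine ⟨(-1) ^ k * P, fun x => ?_⟩
  have h : Real.exp (x ^ 2) * Real.exp (-x ^ 2) = 1 := by rw [← Real.exp_add]; simp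
  rw [hermite, hP]
  simp only [Polynomial.eval_mul, Polynomial.eval_pow, Polynomial.eval_neg, Polynomial.eval_one]
  linear_combination (-1) ^ k * P.eval x * h

lemma exists_abs_eval_le (P : Polynomial ℝ) :
    ∃ C : ℝ, 0 ≤ C ∧ ∀ x, |P.eval x| ≤ C * (1 + |x|) ^ P.natDegree := by
  refine ⟨∑ i ∈ Finset.range (P.natDegree + 1), |P.coeff i|, by positivity, fun x => ?_⟩
  rw [Polynomial.eval_eq_sum_range, Finset.sum_mul]
  refine (Finset.abs_sum_le_sum_abs _ _).trans (Finset.sum_le_sum fun i hi => ?_)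
  rw [abs_mul, abs_pow]
  gcongr
  calc |x| ^ i ≤ (1 + |x|) ^ i := by gcongr; linarith [abs_nonneg x]
    _ ≤ _ := pow_le_pow_right₀ (by linarith [abs_nonneg x]) (Finset.mem_range_succ_iff.1 hi)

lemma continuous_hermiteScaled (α : Fin n → ℕ) :
    Continuous (hermiteScaled α : Space n → ℝ) := by
  unfold hermiteScaled
  refine continuous_finsetProd _ fun j _ => ?_
  obtain ⟨P, hP⟩ := exists_polynomial_hermite (α j)
  simp_rw [hP]
  exact P.continuous.comp (by fun_prop)

lemma exists_abs_hermiteScaled_le (α : Fin n → ℕ) : ∃ (C : ℝ) (N : ℕ), 0 ≤ C ∧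
    ∀ x : Space n, |hermiteScaled α x| ≤ C * (1 + ‖x‖) ^ N := by
  choose P hP using fun j => exists_polynomial_hermite (α j)
  choose C hC0 hC using fun j => exists_abs_eval_le (P j)
  refine ⟨∏ j, C j, ∑ j, (P j).natDegree, Finset.prod_nonneg fun j _ => hC0 j, fun x => ?_⟩
  rw [hermiteScaled, Finset.abs_prod, ← Finset.prod_pow_eq_pow_sum, ← Finset.prod_mul_distrib]
  refine Finset.prod_le_prod (fun j _ => abs_nonneg _) fun j _ => ?_
  rw [hP]
  refine (hC j _).trans ?_
  have h := PiLp.norm_apply_le x j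
  rw [Real.norm_eq_abs] at h
  have h2 : |x j / 2| ≤ ‖x‖ := by
    rw [abs_div, abs_two]; linarith [abs_nonneg (x j)]
  have := hC0 j
  gcongr

/-- The Hermite functions `h_α G₁` are bounded and integrable. -/
lemma hermiteScaled_mul_gaussKernel_bounds (α : Fin n → ℕ) :
    Integrable (fun y : Space n => hermiteScaled α y * gaussKernel 1 y) ∧
    ∃ C : ℝ, ∀ y : Space n, |hermiteScaled α y * gaussKernel 1 y| ≤ C := by
  obtain ⟨C, N, hC0, hC⟩ := exists_abs_hermiteScaled_le α
  obtain ⟨D, hD0, hD⟩ := one_add_pow_mul_exp_le N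
  have hle : ∀ y : Space n, |hermiteScaled α y * gaussKernel 1 y| ≤
      C * ((1 + ‖y‖) ^ N * gaussKernel 1 y) := fun y => by
    rw [abs_mul, abs_of_nonneg (gaussKernel_nonneg 1 zero_le_one y), ← mul_assoc]
    exact mul_le_mul_of_nonneg_right (hC y) (gaussKernel_nonneg 1 zero_le_one y)
  refine ⟨((integrable_weight_mul_gaussKernel_one N).const_mul C).mono'
    ((continuous_hermiteScaled α).mul (continuous_gaussKernel 1)).aestronglyMeasurable
    (Eventually.of_forall hle), C * ((4 * Real.pi) ^ (-(n : ℝ) / 2) * D), fun y => ?_⟩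
  refine (hle y).trans (mul_le_mul_of_nonneg_left ?_ hC0)
  rw [gaussKernel_one_eq, mul_left_comm]
  refine mul_le_mul_of_nonneg_left ((hD _ (norm_nonneg y)).trans
    (mul_le_of_le_one_right hD0 (Real.exp_le_one_iff.2 ?_))) (by positivity)
  nlinarith [sq_nonneg ‖y‖]

/-! ### Dilations and the asymptotic profile -/

lemma integrable_dilation {ψ : Space n → ℝ} (hψ : Integrable ψ) {t : ℝ} (ht : 0 < t) :
    Integrable (dilation t ψ) :=
  (hψ.comp_smul (Real.rpow_pos_of_pos ht _).ne').const_mul _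

lemma integral_abs_dilation (ψ : Space n → ℝ) {t : ℝ} (ht : 0 < t) :
    ∫ x, |dilation t ψ x| = ∫ x, |ψ x| := by
  rw [integral_eq_sqrt_pow_mul_integral_smul ht, ← integral_const_mul]
  congr 1; ext z
  rw [dilation, smul_smul, rpow_neg_half_mul_sqrt ht, one_smul, abs_mul,
    abs_of_pos (Real.rpow_pos_of_pos ht _), ← mul_assoc, sqrt_pow_mul_rpow ht, one_mul]

/-- δ_t preserves the L¹ norm and scales the L^∞ norm by t^{-n/2}, so the weighted norm is bounded
uniformly in t; intermediate q follow by interpolation. -/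
lemma weighted_eLpNorm_dilation_le {ψ : Space n → ℝ} (hψ : Integrable ψ) {C : ℝ}
    (hC : ∀ y, |ψ y| ≤ C) {q : ℝ≥0∞} (hq : 1 ≤ q) {t : ℝ} (ht : 0 < t) :
    ENNReal.ofReal (t ^ decayExponent n q) * eLpNorm (dilation t ψ) q volume ≤
      ENNReal.ofReal (max (∫ x, |ψ x|) C) := by
  refine ofReal_rpow_mul_eLpNorm_le ht ?_ ?_ hq
  · rw [← integral_abs_dilation ψ ht, eLpNorm_one_eq_lintegral_enorm,
      ← ofReal_integral_norm_eq_lintegral_enorm (integrable_dilation hψ ht)]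
    exact ENNReal.ofReal_le_ofReal (le_max_left _ _)
  · have h : eLpNorm (dilation t ψ) ∞ volume ≤ ENNReal.ofReal (t ^ (-(n : ℝ) / 2) * C) := by
      refine eLpNorm_top_le_ofReal (Eventually.of_forall fun x => ?_)
      rw [dilation, abs_mul, abs_of_pos (Real.rpow_pos_of_pos ht _)]
      exact mul_le_mul_of_nonneg_left (hC _) (Real.rpow_nonneg ht.le _)
    refine (mul_le_mul_right h _).trans ?_
    rw [← ENNReal.ofReal_mul (by positivity), ← mul_assoc, ← Real.rpow_add ht]
    refine ENNReal.ofReal_le_ofReal (le_trans (le_of_eq ?_) (le_max_right _ _))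
    ring_nf; simp

lemma dilation_hermiteScaled_zero {t : ℝ} (ht : 0 < t) (x : Space n) :
    dilation t (fun y => hermiteScaled 0 y * gaussKernel 1 y) x = gaussKernel t x := by
  rw [gaussKernel_scale ht x, dilation]
  simp [hermiteScaled, hermite, ← Real.exp_add]

/-- Isolates the only term that survives in the limit: h₀ = 1, and δ_t G₁ = G_t. -/
lemma profile_eq {m : ℕ} (c : (Fin n → ℕ) → ℝ) {t : ℝ} (ht : 0 < t) (x : Space n) :
    profile m c t x = c 0 * gaussKernel t x +
      ∑ k ∈ Finset.range m, ∑ α ∈ Finset.piAntidiag (Finset.univ : Finset (Fin n)) (k + 1),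
        ((2 : ℝ) ^ (-((k + 1 : ℕ) : ℝ)) * t ^ (-((k + 1 : ℕ) : ℝ) / 2) * c α) *
          dilation t (fun y => hermiteScaled α y * gaussKernel 1 y) x := by
  rw [profile, Finset.sum_range_succ', add_comm]
  congr 1
  · rw [Finset.piAntidiag_zero, Finset.sum_singleton, dilation_hermiteScaled_zero ht]
    simp
  · refine Finset.sum_congr rfl fun k _ => ?_
    rw [Finset.mul_sum]
    refine Finset.sum_congr rfl fun α _ => ?_
    ring

/-- Each dilated term has bounded weighted norm and carries a factor t^{-(k+1)/2}. The coefficients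
c are arbitrary, so the higher moments do not influence the limit. -/
lemma tendsto_weighted_eLpNorm_remainder (m : ℕ) (c : (Fin n → ℕ) → ℝ) {q : ℝ≥0∞} (hq : 1 ≤ q) :
    Tendsto (fun t : ℝ => ENNReal.ofReal (t ^ decayExponent n q) *
      eLpNorm (fun x => profile m c t x - c 0 * gaussKernel t x) q volume) atTop (𝓝 0) := by
  set ψ : (Fin n → ℕ) → Space n → ℝ := fun α y => hermiteScaled α y * gaussKernel 1 y with hψ
  have hψi : ∀ α, Integrable (ψ α) := fun α => (hermiteScaled_mul_gaussKernel_bounds α).1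
  choose C hC using fun α => (hermiteScaled_mul_gaussKernel_bounds (n := n) α).2
  set A : (Fin n → ℕ) → ℝ := fun α => max (∫ x, |ψ α x|) (C α) with hA
  set b : ℕ → (Fin n → ℕ) → ℝ → ℝ := fun k α t =>
    (2 : ℝ) ^ (-((k + 1 : ℕ) : ℝ)) * t ^ (-((k + 1 : ℕ) : ℝ) / 2) * c α with hb
  have hb0 : ∀ k α, Tendsto (b k α) atTop (𝓝 0) := fun k α => by
    have h : Tendsto (fun t : ℝ => t ^ (-((k + 1 : ℕ) : ℝ) / 2)) atTop (𝓝 0) := by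
      simp_rw [neg_div]
      exact tendsto_rpow_neg_atTop (by positivity)
    have h' := (h.const_mul ((2 : ℝ) ^ (-((k + 1 : ℕ) : ℝ)))).mul_const (c α)
    rwa [mul_zero, zero_mul] at h'
  have hlim : Tendsto (fun t : ℝ => ∑ k ∈ Finset.range m,
      ∑ α ∈ Finset.piAntidiag (Finset.univ : Finset (Fin n)) (k + 1),
        ‖b k α t‖ₑ * ENNReal.ofReal (A α)) atTop (𝓝 0) := by
    rw [show (0 : ℝ≥0∞) = ∑ k ∈ Finset.range m,
      ∑ α ∈ Finset.piAntidiag (Finset.univ : Finset (Fin n)) (k + 1), 0 by simp]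
    refine tendsto_finsetSum _ fun k _ => tendsto_finsetSum _ fun α _ => ?_
    have := ENNReal.Tendsto.mul_const (b := ENNReal.ofReal (A α)) (hb0 k α).enorm
      (Or.inr ENNReal.ofReal_ne_top)
    simpa using this
  refine tendsto_of_tendsto_of_tendsto_of_le_of_le' tendsto_const_nhds hlim
    (Eventually.of_forall fun t => zero_le) ?_
  filter_upwards [eventually_gt_atTop 0] with t ht
  have heq : (fun x => profile m c t x - c 0 * gaussKernel t x) = ∑ k ∈ Finset.range m,
      ∑ α ∈ Finset.piAntidiag (Finset.univ : Finset (Fin n)) (k + 1),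
        b k α t • dilation t (ψ α) := by
    ext x
    simp [profile_eq c ht, hb, hψ]
  have hmeas : ∀ k α, AEStronglyMeasurable (b k α t • dilation t (ψ α)) volume := fun k α =>
    (integrable_dilation (hψi α) ht).aestronglyMeasurable.const_smul _
  rw [heq]
  calc _ ≤ ENNReal.ofReal (t ^ decayExponent n q) * ∑ k ∈ Finset.range m,
        ∑ α ∈ Finset.piAntidiag (Finset.univ : Finset (Fin n)) (k + 1),
          eLpNorm (b k α t • dilation t (ψ α)) q volume := by
        gcongr
        refine (eLpNorm_sum_le (fun k _ =>
          Finset.aestronglyMeasurable_sum _ fun α _ => hmeas k α) hq).trans ?_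
        exact Finset.sum_le_sum fun k _ => eLpNorm_sum_le (fun α _ => hmeas k α) hq
    _ ≤ _ := by
        simp_rw [Finset.mul_sum]
        refine Finset.sum_le_sum fun k _ => Finset.sum_le_sum fun α _ => ?_
        rw [eLpNorm_const_smul, mul_left_comm]
        gcongr
        exact weighted_eLpNorm_dilation_le (hψi α) (hC α) hq ht

lemma HeatSmall.weighted_eLpNorm_le {t e : ℝ} {g : L1 n} (h : HeatSmall t e g) (ht : 0 < t)
    {q : ℝ≥0∞} (hq : 1 ≤ q) :
    ENNReal.ofReal (t ^ decayExponent n q) * eLpNorm g q volume ≤ ENNReal.ofReal e := by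
  refine ofReal_rpow_mul_eLpNorm_le ht ?_ ?_ hq
  · rw [eLpNorm_one_coeFn]
    exact ENNReal.ofReal_le_ofReal h.1
  · refine (mul_le_mul_right (eLpNorm_top_le_ofReal h.2) _).trans (le_of_eq ?_)
    rw [← ENNReal.ofReal_mul (by positivity), mul_left_comm, ← Real.rpow_add ht]
    congr 1
    ring_nf; simp

/-- Identifies the leading coefficient of the profile with the limiting mass. -/
lemma momentCoeff_zero (g : L1 n) : momentCoeff g 0 = massCLM g := by
  rw [massCLM_apply, momentCoeff]
  simp [multiFactorial, monomial]

section Profile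

variable {p K : ℝ} {f : ℝ → ℝ} {φ : L1 n} {a : ℝ → ℝ} {u : ℝ → L1 n}

theorem SmallData.tendsto_sub_profile (hd : SmallData p K f φ a) (hu : Dominated φ u)
    (hfix : duhamel f φ u = u) (m : ℕ) {q : ℝ≥0∞} (hq : 1 ≤ q) :
    Tendsto (fun t : ℝ => ENNReal.ofReal (t ^ decayExponent n q) *
      eLpNorm (fun x => u t x - profile m
        (momentCoeff (φ + ∫ s in Ioi (0 : ℝ), superposition f (u s) : L1 n)) t x) q volume)
      atTop (𝓝 0) := by
  set φ₁ : L1 n := φ + ∫ s in Ioi (0 : ℝ), superposition f (u s) with hφ₁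
  set c := momentCoeff (φ₁ : Space n → ℝ)
  have hlead : Tendsto (fun t : ℝ => ENNReal.ofReal (t ^ decayExponent n q) *
      eLpNorm (u t - massCLM φ₁ • gaussL1 t : L1 n) q volume) atTop (𝓝 0) := by
    rw [ENNReal.tendsto_nhds_zero]
    intro ε hε
    obtain ⟨e, he, heε⟩ : ∃ e : ℝ, 0 < e ∧ ENNReal.ofReal e ≤ ε := by
      rcases eq_or_ne ε ∞ with rfl | h
      · exact ⟨1, one_pos, le_top⟩
      · exact ⟨ε.toReal, ENNReal.toReal_pos hε.ne' h, ENNReal.ofReal_toReal_le⟩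
    filter_upwards [hd.eventually_heatSmall hu hfix he, eventually_gt_atTop 0] with t h ht
    exact (h.weighted_eLpNorm_le ht hq).trans heε
  have hsum := hlead.add (tendsto_weighted_eLpNorm_remainder m c hq)
  rw [add_zero] at hsum
  refine tendsto_of_tendsto_of_tendsto_of_le_of_le' tendsto_const_nhds hsum
    (Eventually.of_forall fun t => zero_le) ?_
  filter_upwards [eventually_gt_atTop 0] with t ht
  rw [← mul_add]
  gcongr
  have hae : (fun x => u t x - profile m c t x) =ᵐ[volume]
      ⇑(u t - massCLM φ₁ • gaussL1 t : L1 n) - fun x => profile m c t x - c 0 * gaussKernel t x := by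
    filter_upwards [Lp.coeFn_sub (u t) (massCLM φ₁ • gaussL1 t),
      Lp.coeFn_smul (massCLM φ₁) (gaussL1 t : L1 n), coeFn_gaussL1 ht] with x h1 h2 h3
    rw [Pi.sub_apply, h1, Pi.sub_apply, h2, Pi.smul_apply, h3, smul_eq_mul, ← momentCoeff_zero]
    ring
  have hmeas : AEStronglyMeasurable (fun x => profile m c t x - c 0 * gaussKernel t x) volume := by
    refine AEStronglyMeasurable.sub ?_ ((continuous_gaussKernel t).aestronglyMeasurable.const_mul _)
    refine Continuous.aestronglyMeasurable ?_
    unfold profile dilation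
    have h1 := fun α => continuous_hermiteScaled (n := n) α
    have h2 := continuous_gaussKernel (n := n) 1
    fun_prop
  rw [eLpNorm_congr_ae hae]
  exact eLpNorm_sub_le (Lp.aestronglyMeasurable _) hmeas hq

end Profile

/-! ### Choice of the smallness threshold -/

/-- The decay rate `E (1 + t)^{-n/2}`, frozen at negative times. -/
noncomputable def decayBound (n : ℕ) (E t : ℝ) : ℝ := E * (1 + max t 0) ^ (-(n : ℝ) / 2)

lemma continuous_decayBound (E : ℝ) : Continuous (decayBound n E) := by
  unfold decayBound
  refine continuous_const.mul (Continuous.rpow_const (by fun_prop) fun t => Or.inl ?_)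
  have := le_max_right t 0
  positivity

lemma decayBound_nonneg {E : ℝ} (hE : 0 ≤ E) (t : ℝ) : 0 ≤ decayBound n E t := by
  have := le_max_right t 0
  unfold decayBound
  positivity

lemma decayBound_le_zero {E : ℝ} (hE : 0 ≤ E) (t : ℝ) : decayBound n E t ≤ decayBound n E 0 := by
  unfold decayBound
  refine mul_le_mul_of_nonneg_left (rpow_neg_half_le (by simp) ?_) hE
  simp

lemma decayBound_rpow {p K E s : ℝ} (hE : 0 ≤ E) (hs : 0 ≤ s) :
    K * decayBound n E s ^ (p - 1) =
      K * E ^ (p - 1) * (s + 1) ^ (-((n : ℝ) * (p - 1) / 2)) := by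
  rw [decayBound, max_eq_left hs, Real.mul_rpow hE (by positivity),
    ← Real.rpow_mul (by positivity), mul_assoc, add_comm]
  congr 3
  ring

/-- For t ≤ 1 the L^∞ bound is used with 1 + max(t,0) ≤ 2, for t > 1 the smoothing bound with 1 + t
≤ 2t. Either comparison costs 2^{n/2}; the remaining 2 comes from the doubled flow. -/
lemma ae_abs_two_smul_heatL1_le {φ : L1 n} {ε : ℝ} (hε : 0 ≤ ε) (h1 : ‖φ‖ ≤ ε)
    (h2 : ∀ᵐ x, |φ x| ≤ ε) (t : ℝ) :
    ∀ᵐ x, |((2 : ℝ) • heatL1 t (|φ|) : L1 n) x| ≤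
      decayBound n (2 * 2 ^ ((n : ℝ) / 2) * ε) t := by
  have hinv : ((2 : ℝ) ^ ((n : ℝ) / 2)) * 2 ^ (-(n : ℝ) / 2) = 1 := by
    rw [← Real.rpow_add two_pos]; ring_nf; simp
  have key : ∀ᵐ x, |heatL1 t (|φ|) x| ≤
      2 ^ ((n : ℝ) / 2) * ε * (1 + max t 0) ^ (-(n : ℝ) / 2) := by
    rcases le_or_gt t 1 with ht | ht
    · have h3 : ∀ᵐ x, |(|φ| : L1 n) x| ≤ ε := by
        filter_upwards [Lp.coeFn_abs φ, h2] with x h3 h4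
        rwa [h3, abs_abs]
      filter_upwards [ae_abs_heatL1_le_of_bounded h3 t] with x hx
      refine hx.trans ?_
      have h4 : (2 : ℝ) ^ (-(n : ℝ) / 2) ≤ (1 + max t 0) ^ (-(n : ℝ) / 2) :=
        rpow_neg_half_le (by have := le_max_right t 0; positivity)
          (by have : max t 0 ≤ 1 := max_le ht zero_le_one
              linarith)
      calc ε = 2 ^ ((n : ℝ) / 2) * ε * 2 ^ (-(n : ℝ) / 2) := by
            rw [mul_right_comm, hinv, one_mul]
        _ ≤ _ := by gcongr
    · have ht0 : 0 < t := by linarith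
      filter_upwards [(heatSmall_heatL1 ht0 (|φ|)).2] with x hx
      refine hx.trans ?_
      rw [norm_abs_eq_norm, max_eq_left ht0.le]
      have h4 : (2 * t) ^ (-(n : ℝ) / 2) ≤ (1 + t) ^ (-(n : ℝ) / 2) :=
        rpow_neg_half_le (by positivity) (by linarith)
      rw [Real.mul_rpow zero_le_two ht0.le] at h4
      calc ‖φ‖ * t ^ (-(n : ℝ) / 2) ≤ ε * t ^ (-(n : ℝ) / 2) := by gcongr
        _ = 2 ^ ((n : ℝ) / 2) * ε * (2 ^ (-(n : ℝ) / 2) * t ^ (-(n : ℝ) / 2)) := by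
            linear_combination (-(ε * t ^ (-(n : ℝ) / 2))) * hinv
        _ ≤ _ := by gcongr
  filter_upwards [key, Lp.coeFn_smul (2 : ℝ) (heatL1 t (|φ|))] with x h3 h4
  rw [h4, Pi.smul_apply, smul_eq_mul, abs_mul, abs_two, decayBound]
  linarith

/-- Sufficiently small data satisfy the standing smallness assumptions. -/
lemma exists_smallData {p K : ℝ} {f : ℝ → ℝ} (hf : PowerLipschitz p K f) (hK : 0 < K)
    (hnp : 2 < (n : ℝ) * (p - 1)) : ∃ E ε : ℝ, 0 < E ∧ 0 < ε ∧
      ∀ φ : L1 n, ‖φ‖ ≤ ε → (∀ᵐ x, |φ x| ≤ ε) → SmallData p K f φ (decayBound n E) := by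
  have hp := hf.one_lt
  set J := ∫ s in Ioi (0 : ℝ), (s + 1) ^ (-((n : ℝ) * (p - 1) / 2)) with hJ
  have hJi : IntegrableOn (fun s : ℝ => (s + 1) ^ (-((n : ℝ) * (p - 1) / 2))) (Ioi 0) :=
    integrableOn_add_rpow_Ioi_of_lt (by linarith) (by norm_num)
  have hnn : ∀ s ∈ Ioi (0 : ℝ), 0 ≤ (s + 1) ^ (-((n : ℝ) * (p - 1) / 2)) := fun s hs => by
    have : (0 : ℝ) < s := hs
    positivity
  have hJ0 : 0 ≤ J := setIntegral_nonneg measurableSet_Ioi hnn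
  -- Solves K E^{p-1}(J+1) = 1/4; using J + 1 in place of J keeps the denominator positive. J is a
  -- convergent integral because n(p-1)/2 > 1.
  set E := (1 / (4 * K * (J + 1))) ^ (1 / (p - 1)) with hE
  have hE0 : 0 < E := by positivity
  have hEp : E ^ (p - 1) = 1 / (4 * K * (J + 1)) := by
    rw [hE, ← Real.rpow_mul (by positivity), one_div_mul_cancel (by linarith), Real.rpow_one]
  -- Inverts the constant of `ae_abs_two_smul_heatL1_le`.
  set ε := E / (2 * 2 ^ ((n : ℝ) / 2)) with hε
  have hε0 : 0 < ε := by positivity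
  have hEε : 2 * 2 ^ ((n : ℝ) / 2) * ε = E := by rw [hε]; field_simp
  refine ⟨E, ε, hE0, hε0, fun φ h1 h2 => ⟨hf, continuous_decayBound E,
    decayBound_le_zero hE0.le, decayBound_nonneg hE0.le, fun t => ?_, fun t ht => ?_⟩⟩
  · rw [← hEε]
    exact ae_abs_two_smul_heatL1_le hε0.le h1 h2 t
  · calc ∫ s in (0 : ℝ)..t, K * decayBound n E s ^ (p - 1)
        = ∫ s in Ioc 0 t, K * E ^ (p - 1) * (s + 1) ^ (-((n : ℝ) * (p - 1) / 2)) := by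
          rw [intervalIntegral.integral_of_le ht]
          exact setIntegral_congr_fun measurableSet_Ioc fun s hs =>
            decayBound_rpow hE0.le hs.1.le
      _ ≤ K * E ^ (p - 1) * J := by
          rw [integral_const_mul]
          refine mul_le_mul_of_nonneg_left ?_ (by positivity)
          exact setIntegral_mono_set hJi (ae_restrict_of_forall_mem measurableSet_Ioi hnn)
            Ioc_subset_Ioi_self.eventuallyLE
      _ ≤ K * E ^ (p - 1) * (J + 1) := by gcongr; linarith
      _ = 1 / 4 := by rw [hEp]; field_simp

/-- The exponent -n(p-1)/2 + m/2 is below -1 exactly when p > 1 + (2+m)/n. -/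
lemma integrableOn_decayBound_moment {p K E : ℝ} (hE : 0 ≤ E) {m : ℕ}
    (hnp : 2 + (m : ℝ) < n * (p - 1)) :
    IntegrableOn (fun s => (K * decayBound n E s ^ (p - 1)) * (1 + s) ^ ((m : ℝ) / 2))
      (Ioi 0) := by
  have h : IntegrableOn
      (fun s : ℝ => (s + 1) ^ (-((n : ℝ) * (p - 1) / 2) + (m : ℝ) / 2)) (Ioi 0) :=
    integrableOn_add_rpow_Ioi_of_lt (by linarith) (by norm_num)
  refine IntegrableOn.congr_fun (h.const_mul (K * E ^ (p - 1))) (fun s hs => ?_)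
    measurableSet_Ioi
  have hs' : (0 : ℝ) < s := hs
  rw [decayBound_rpow hE hs'.le, Real.rpow_add (by positivity), add_comm 1 s]
  ring

/-- The interpolation for `HeatSmall` is used at the shifted time 1 + t, which includes t = 0. -/
lemma SmallData.weighted_eLpNorm_le {p K E : ℝ} {f : ℝ → ℝ} {φ : L1 n} {u : ℝ → L1 n}
    (hd : SmallData p K f φ (decayBound n E)) (hu : Dominated φ u) {q : ℝ≥0∞} (hq : 1 ≤ q)
    {t : ℝ} (ht : 0 ≤ t) :
    ENNReal.ofReal ((1 + t) ^ decayExponent n q) * eLpNorm (u t) q volume ≤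
      ENNReal.ofReal (max (2 * ‖φ‖) E) := by
  refine HeatSmall.weighted_eLpNorm_le ⟨?_, ?_⟩ (by positivity) hq
  · exact (hu.norm_le t).trans (le_max_left _ _)
  · filter_upwards [hd.ae_abs_le hu t] with x hx
    rw [decayBound, max_eq_left ht] at hx
    exact hx.trans (mul_le_mul_of_nonneg_right (le_max_right _ _) (by positivity))

end SemilinearHeat

/-! ### Assembly of the main theorem -/

open SemilinearHeat
theorem corollaryB3 (n : ℕ) (hn : 0 < n) (p K : ℝ) (hp : 1 + 2 / (n : ℝ) < p) (hK : 0 < K)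
    (f : ℝ → ℝ)
    (hf : ∀ ξ η : ℝ, |f ξ - f η| ≤ K * (|ξ| ^ (p - 1) + |η| ^ (p - 1)) * |ξ - η|)
    (hf0 : f 0 = 0) :
    ∃ ε₀ : ℝ, 0 < ε₀ ∧
      ∀ φ : Space n → ℝ, MemLp φ 1 volume → MemLp φ ∞ volume →
        eLpNorm φ 1 volume + eLpNorm φ ∞ volume ≤ ENNReal.ofReal ε₀ →
        ∃ u : ℝ → L1 n,
          -- `u` is the unique global solution in `X`, and it decays like the heat kernel
          IsGlobalSolution f φ u ∧
          (∀ v : ℝ → L1 n, IsGlobalSolution f φ v → EqOn v u (Ici 0)) ∧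
          (⨆ q ∈ Ici (1 : ℝ≥0∞), ⨆ t ∈ Ici (0 : ℝ),
            ENNReal.ofReal ((1 + t) ^ decayExponent n q) * eLpNorm (u t) q volume) < ∞ ∧
          -- the asymptotic expansion, for every admissible order `m`
          ∀ m : ℕ, 1 + (2 + (m : ℝ)) / (n : ℝ) < p → MemL1Weighted m φ →
            -- `φ₁` and its moments are well defined
            IntegrableOn (fun s : ℝ => toL1 (fun x => f (u s x))) (Ioi 0) volume ∧
            MemL1Weighted m (phiOne f φ u) ∧
            ∀ q : ℝ≥0∞, 1 ≤ q →
              Tendsto (fun t : ℝ => ENNReal.ofReal (t ^ decayExponent n q) *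
                  eLpNorm (fun x => u t x - profile m (momentCoeff (phiOne f φ u)) t x) q volume)
                atTop (𝓝 0) := by
  have hn' : (0 : ℝ) < n := Nat.cast_pos.2 hn
  have hexp : ∀ c : ℝ, 1 + c / (n : ℝ) < p → c < n * (p - 1) := fun c hc => by
    have : c / n < p - 1 := by linarith
    rwa [div_lt_iff₀' hn'] at this
  have hp1 : 1 < p := (lt_add_of_pos_right 1 (by positivity)).trans hp
  have hfP : PowerLipschitz p K f := ⟨hp1, hK.le, hf0, hf⟩
  obtain ⟨E, ε, hE, hε, hsmall⟩ := exists_smallData (n := n) hfP hK (hexp 2 hp)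
  refine ⟨ε, hε, fun φ hφ1 _ hφε => ?_⟩
  have hφi : Integrable φ := memLp_one_iff_integrable.1 hφ1
  have hcoe := coeFn_toL1 hφi
  have hnorm : ‖toL1 φ‖ ≤ ε := by
    rw [← ENNReal.ofReal_le_ofReal_iff hε.le, ← eLpNorm_one_coeFn, eLpNorm_congr_ae hcoe]
    exact le_self_add.trans hφε
  have hsup : ∀ᵐ x, |toL1 φ x| ≤ ε := by
    have h := ae_abs_le_of_eLpNorm_top_le (M := ε.toNNReal)
      ((le_add_self.trans hφε : eLpNorm φ ∞ volume ≤ _))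
    rw [Real.coe_toNNReal _ hε.le] at h
    filter_upwards [hcoe, h] with x h1 h2
    rwa [h1]
  have hd := hsmall (toL1 φ) hnorm hsup
  obtain ⟨u, hu, hfix⟩ := hd.exists_fixedPoint
  have hsol := hd.isGlobalSolution hu hfix hφi rfl
  refine ⟨u, hsol, fun v hv => hsol.eqOn hfP hv, ?_, fun m hm hφm => ⟨?_, ?_, fun q hq => ?_⟩⟩
  · refine lt_of_le_of_lt (iSup₂_le fun q hq => iSup₂_le fun t ht =>
      hd.weighted_eLpNorm_le hu hq ht) ENNReal.ofReal_lt_top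
  · exact hd.integrableOn_superposition hu
  -- `phiOne` unfolds to φ plus the integral of the superposition, so the weighted estimate applies
  -- directly; the threshold on p for the given m supplies the integrable weight.
  · refine memL1Weighted_of_integrable_weight (integrable_L1 _).aestronglyMeasurable
      (hd.integrable_weight_mul hu m ?_ (integrableOn_decayBound_moment hE.le (hexp _ hm)))
    refine (integrable_weight_mul_of_memL1Weighted hφm).congr ?_
    filter_upwards [hcoe] with x hx
    rw [hx]
  · exact hd.tendsto_sub_profile hu hfix m hq
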